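/- Let $a<b$, $\lambda>0$, and let $K:[0,\infty)\to[0,\infty)$ satisfy: (K1) $K$ is continuous and strictly increasing with $K(0)=0$; (K2) for every $M>0$ there is a constant $C_M>0$ such that $K(\rho_1)+K(\rho_2)\ge K(\rho_1+\rho_2)+C_M\rho_1\rho_2$ for all $\rho_1,\rho_2\ge 0$ with $\rho_1+\rho_2\le M$; (K3) $\lim_{\rho\downarrow 0}K(\rho)/\rho=1$. For $u\in BV(a,b)$ (that is, $u\in L^1(a,b)$ and its distributional derivative $Du$ is a finite signed measure on $(a,b)$), let $J_u\subset(a,b)$ be the set of points at which $u$ has two different one-sided approximate limits $u^\pm$, and set $$TV_{Kg}(u)=|Du|\big((a,b)\setminus J_u\big)+\sum_{x\in J_u}K\big(|u^+(x)-u^-(x)|\big)+\frac{\lambda}{2}\int_a^b|u-g|^2\,dx .$$ **Theorem 1.2.** Assume that $g\in C[a,b]$ is non-decreasing (resp. non-increasing), and let $U\in BV(a,b)$ be a minimizer of $TV_{Kg}$ over $BV(a,b)$. Then $U$ (that is, a representative of $U$ on $[a,b]$ that is continuous outside $J_U$, one-sidedly at $a$ and $b$) is a non-decreasing (resp. non-increasing)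 piecewise constant function, with finitely many pieces, satisfying $\inf_{[a,b]}g\le U\le\sup_{[a,b]}g$ on $[a,b]$. Moreover, for every $M>0$ with $M\ge|g(b)-g(a)|$ and every constant $C_M$ as in (K2) for this $M$, the number $m$ of jumps of $U$ satisfies $$m\le\left[\frac{(b-a)\lambda}{2C_M}\right]+1,$$ where $[r]$ denotes the integer part of $r\ge 0$. -/

import Mathlib

open MeasureTheory Set Filter Topology
open scoped ENNReal ContDiff

noncomputable section

namespace JumpTV

/-! ### Assumptions on the jump density `K : [0,∞) → [0,∞)`

`K` is a function on `ℝ`, of which only the values on `[0,∞)` are used. -/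

/-- (K1): `K` is continuous and strictly increasing on `[0,∞)` with `K 0 = 0`. -/
def CondK1 (K : ℝ → ℝ) : Prop :=
  ContinuousOn K (Ici 0) ∧ StrictMonoOn K (Ici 0) ∧ K 0 = 0

/-- `C` is an admissible constant `C_M` in (K2) for the bound `M`. -/
def IsK2Const (K : ℝ → ℝ) (M C : ℝ) : Prop :=
  0 < C ∧ ∀ ρ₁ ρ₂ : ℝ, 0 ≤ ρ₁ → 0 ≤ ρ₂ → ρ₁ + ρ₂ ≤ M →
    K (ρ₁ + ρ₂) + C * ρ₁ * ρ₂ ≤ K ρ₁ + K ρ₂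

/-- (K2): for every `M > 0` there is an admissible constant `C_M`. -/
def CondK2 (K : ℝ → ℝ) : Prop :=
  ∀ M : ℝ, 0 < M → ∃ C : ℝ, IsK2Const K M C

/-- (K3): `K ρ / ρ → 1` as `ρ ↓ 0`. -/
def CondK3 (K : ℝ → ℝ) : Prop :=
  Tendsto (fun ρ : ℝ => K ρ / ρ) (𝓝[>] 0) (𝓝 1)

/-! ### Functions of bounded variation on the interval `(a,b)` -/

/-- The finite signed measure `μ`, concentrated on `(a,b)`, is the distributional derivative of `u`
on `(a,b)`: `∫ u φ' dx = - ∫ φ dμ` for all test functions `φ ∈ C_c^∞(a,b)`. -/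
def IsDistribDeriv (a b : ℝ) (u : ℝ → ℝ) (μ : SignedMeasure ℝ) : Prop :=
  μ.totalVariation (Ioo a b)ᶜ = 0 ∧
  ∀ φ : ℝ → ℝ, ContDiff ℝ ∞ φ → HasCompactSupport φ → tsupport φ ⊆ Ioo a b →
    ∫ x in Ioo a b, u x * deriv φ x =
      -((∫ x, φ x ∂μ.toJordanDecomposition.posPart) -
        ∫ x, φ x ∂μ.toJordanDecomposition.negPart)

/-- `u ∈ BV(a,b)`: `u` is integrable on `(a,b)` and its distributional derivative is a finite
signed measure. -/
def MemBV (a b : ℝ) (u : ℝ → ℝ) : Prop :=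
  IntegrableOn u (Ioo a b) ∧ ∃ μ : SignedMeasure ℝ, IsDistribDeriv a b u μ

open Classical in
/-- The distributional derivative `Du` on `(a,b)` (zero if `u` is not in `BV(a,b)`). -/
def distribDeriv (a b : ℝ) (u : ℝ → ℝ) : SignedMeasure ℝ :=
  if h : ∃ μ : SignedMeasure ℝ, IsDistribDeriv a b u μ then h.choose else 0

/-- `l` is the approximate limit of `u` at `x` from the left. -/
def IsApproxLeftLim (u : ℝ → ℝ) (x l : ℝ) : Prop :=
  Tendsto (fun r : ℝ => ⨍ y in Ioo (x - r) x, |u y - l|) (𝓝[>] 0) (𝓝 0)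

/-- `l` is the approximate limit of `u` at `x` from the right. -/
def IsApproxRightLim (u : ℝ → ℝ) (x l : ℝ) : Prop :=
  Tendsto (fun r : ℝ => ⨍ y in Ioo x (x + r), |u y - l|) (𝓝[>] 0) (𝓝 0)

/-- The (approximate) jump set `J_u` of `u` in `(a,b)`. -/
def jumpSet (a b : ℝ) (u : ℝ → ℝ) : Set ℝ :=
  {x | x ∈ Ioo a b ∧ ∃ l r : ℝ, l ≠ r ∧ IsApproxLeftLim u x l ∧ IsApproxRightLim u x r}

open Classical in
/-- The trace of `u` at `x` from the left (zero if it does not exist). -/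
def leftTrace (u : ℝ → ℝ) (x : ℝ) : ℝ :=
  if h : ∃ l : ℝ, IsApproxLeftLim u x l then h.choose else 0

open Classical in
/-- The trace of `u` at `x` from the right (zero if it does not exist). -/
def rightTrace (u : ℝ → ℝ) (x : ℝ) : ℝ :=
  if h : ∃ l : ℝ, IsApproxRightLim u x l then h.choose else 0

/-! ### The energy -/

/-- `TV_K(u) = |Du|((a,b) ∖ J_u) + ∑_{x ∈ J_u} K(|u⁺ - u⁻|)`, for `u ∈ BV(a,b)`. -/
def TVK (K : ℝ → ℝ) (a b : ℝ) (u : ℝ → ℝ) : ℝ≥0∞ :=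
  (distribDeriv a b u).totalVariation (Ioo a b \ jumpSet a b u) +
    ∑' x : jumpSet a b u, ENNReal.ofReal (K |rightTrace u x - leftTrace u x|)

/-- The fidelity term `(λ/2) ∫_a^b |u - g|² dx`. -/
def fidelity (lam : ℝ) (g : ℝ → ℝ) (a b : ℝ) (u : ℝ → ℝ) : ℝ≥0∞ :=
  ENNReal.ofReal (lam / 2) * ∫⁻ x in Ioo a b, ENNReal.ofReal (|u x - g x| ^ 2)

/-- `TV_{Kg}(u) = TV_K(u) + (λ/2) ∫_a^b |u - g|² dx`. -/
def TVKg (K : ℝ → ℝ) (lam : ℝ) (g : ℝ → ℝ) (a b : ℝ) (u : ℝ → ℝ) : ℝ≥0∞ :=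
  TVK K a b u + fidelity lam g a b u

/-- `U` is a minimizer of `TV_{Kg}` in `BV(a,b)`. -/
def IsMinimizer (K : ℝ → ℝ) (lam : ℝ) (g : ℝ → ℝ) (a b : ℝ) (U : ℝ → ℝ) : Prop :=
  MemBV a b U ∧ ∀ v : ℝ → ℝ, MemBV a b v → TVKg K lam g a b U ≤ TVKg K lam g a b v

/-! ### The properties of minimizers -/

/-- `V` represents `U` on `(a,b)` (they agree almost everywhere), and `V` is continuous on `[a,b]`
outside the jump set of `U`, one-sided at the end points. -/
def IsGoodRep (a b : ℝ) (U V : ℝ → ℝ) : Prop :=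
  V =ᵐ[volume.restrict (Ioo a b)] U ∧
  ∀ x ∈ Icc a b \ jumpSet a b U, ContinuousWithinAt V (Icc a b) x

/-- `V` is piecewise constant on `(a,b)`: there is a partition `a = t₀ < t₁ < ⋯ < t_{n+1} = b` such
that `V` is constant on each open interval `(t_i, t_{i+1})`. -/
def IsPiecewiseConst (a b : ℝ) (V : ℝ → ℝ) : Prop :=
  ∃ (n : ℕ) (t : ℕ → ℝ) (c : ℕ → ℝ), t 0 = a ∧ t (n + 1) = b ∧
    ∀ i ≤ n, t i < t (i + 1) ∧ ∀ x ∈ Ioo (t i) (t (i + 1)), V x = c i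

end JumpTV

end

namespace JumpTV

/-! ### The jump density -/

section JumpDensity

variable {K : ℝ → ℝ}

/-! Changing the sign of `U` and `g` reduces everything to nondecreasing `g`. By du Bois-Reymond a
BV function is a.e. `c + μ(-∞,x]`, so its jump energy depends only on the measure `|μ|`: diffuse
mass plus `K` of the atoms (`TVK_eq`). This energy is monotone under `≤` of measures, and strictly
so where it is finite (`eq_of_jumpEnergy_univ_le`).

Monotonicity of `U`: `exists_monotone_competitor` gives a nondecreasing function at least as close
to `g`, whose derivative is bounded by the positive part of `DU`. Minimality then forces the
negative part to vanish. Truncation to `[g a, g b]` yields the bounds in the same spirit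
(`IsMinimizer.bounds`).

Jumps: let `p = DU`, and merge all the mass of `p` on `[x,y]` into a single jump, placed where `g`
crosses the midpoint of the values of `U` on the two sides. If a point `w` splits the mass into `A`
and `B`, (K2) together with subadditivity and `K r ≤ r` shows that at least `C * A * B` is gained.
The squared distance to `g` grows pointwise by at most `A * B`, so the fidelity loss is at most `lam
/ 2 * D * (y - x)`, where `D` is the supremum of `A * B` over all splittings. Minimality and a
supremum over `w` give `C * D ≤ lam / 2 * (y - x) * D`, hence `D = 0` once `y - x < 2 * C / lam`
(`IsMinimizer.interaction_eq_zero`).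

If every splitting has a massless side, `p` on `[x,y]` sits at one point. So `p` has no diffuse
part, its atoms are at least `2 * C / lam` apart, and counting them gives both finiteness and the
bound on their number. -/

lemma CondK1.nonneg (hK : CondK1 K) {r : ℝ} (hr : 0 ≤ r) : 0 ≤ K r := by
  rw [← hK.2.2]
  exact hK.2.1.monotoneOn (mem_Ici.2 le_rfl) hr hr

lemma CondK1.mono (hK : CondK1 K) {r s : ℝ} (hr : 0 ≤ r) (hrs : r ≤ s) : K r ≤ K s :=
  hK.2.1.monotoneOn hr (hr.trans hrs) hrs

lemma CondK2.subadditive (hK : CondK2 K) {r s : ℝ} (hr : 0 ≤ r) (hs : 0 ≤ s) :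
    K (r + s) ≤ K r + K s := by
  obtain ⟨C, hC, h⟩ := hK (r + s + 1) (by positivity)
  have := h r s hr hs (by linarith)
  have : 0 ≤ C * r * s := by positivity
  linarith

lemma CondK2.le_nat_mul (hK1 : CondK1 K) (hK : CondK2 K) {r : ℝ} (hr : 0 ≤ r) (n : ℕ) :
    K (n * r) ≤ n * K r := by
  induction n with
  | zero => simp [hK1.2.2]
  | succ n ih =>
    have := hK.subadditive (r := n * r) (s := r) (by positivity) hr
    push_cast
    rw [add_mul, add_mul, one_mul, one_mul]
    linarith

/-- Subadditivity bounds `K r` by `n * K (r / n)`, which tends to `r` by (K3). -/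
lemma CondK2.le_self (hK1 : CondK1 K) (hK : CondK2 K) (hK3 : CondK3 K) {r : ℝ} (hr : 0 ≤ r) :
    K r ≤ r := by
  rcases hr.eq_or_lt with rfl | hr
  · exact hK1.2.2.le
  have ht : Tendsto (fun n : ℕ => r / ((n : ℝ) + 1)) atTop (𝓝[>] 0) := by
    refine tendsto_nhdsWithin_iff.2 ⟨?_, Eventually.of_forall fun n => by simp; positivity⟩
    simpa [div_eq_mul_inv] using (tendsto_one_div_add_atTop_nhds_zero_nat (𝕜 := ℝ)).const_mul r
  have h1 : Tendsto (fun n : ℕ => r * (K (r / ((n : ℝ) + 1)) / (r / ((n : ℝ) + 1)))) atTop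
      (𝓝 (r * 1)) := (hK3.comp ht).const_mul r
  rw [mul_one] at h1
  refine ge_of_tendsto' h1 fun n => ?_
  have hn : (0 : ℝ) < (n : ℝ) + 1 := by positivity
  have h2 := hK.le_nat_mul hK1 (r := r / ((n : ℝ) + 1)) (by positivity) (n + 1)
  push_cast at h2
  rw [mul_div_cancel₀ _ hn.ne'] at h2
  refine h2.trans (le_of_eq ?_)
  field_simp

end JumpDensity

/-! ### The energy of a finite measure: mass of the diffuse part, `K` of the atoms -/

section JumpEnergy

lemma measure_eq_zero_of_countable {p : Measure ℝ} {S : Set ℝ} (hS : S.Countable)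
    (h : ∀ x ∈ S, p {x} = 0) : p S = 0 := by
  rw [← biUnion_of_singleton S]
  exact (measure_biUnion_null_iff hS).2 h

lemma countable_atoms (p : Measure ℝ) [IsFiniteMeasure p] : {x | p {x} ≠ 0}.Countable := by
  have := Measure.countable_meas_pos_of_disjoint_iUnion (μ := p) (As := fun x : ℝ => {x})
    (fun x => measurableSet_singleton x) (fun x y hxy => by simpa using hxy)
  simpa [pos_iff_ne_zero] using this

lemma measurableSet_nonatoms (p : Measure ℝ) [IsFiniteMeasure p] :
    MeasurableSet {x | p {x} = 0} := by
  have := (countable_atoms p).measurableSet.compl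
  simpa [compl_ofPred] using this

/-- The energy density associated with the jump density `K` and the measure `p`. -/
noncomputable def jumpEnergy (K : ℝ → ℝ) (p : Measure ℝ) : Measure ℝ :=
  p.restrict {x | p {x} = 0} +
    Measure.sum fun x => ENNReal.ofReal (K (p.real {x})) • Measure.dirac x

variable {K : ℝ → ℝ} {p q : Measure ℝ}

lemma jumpEnergy_apply {S : Set ℝ} (hS : MeasurableSet S) :
    jumpEnergy K p S = p (S ∩ {x | p {x} = 0}) +
      ∑' x, S.indicator (fun x => ENNReal.ofReal (K (p.real {x}))) x := by
  rw [jumpEnergy, Measure.add_apply, Measure.restrict_apply hS, Measure.sum_apply _ hS]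
  congr 1
  refine tsum_congr fun x => ?_
  by_cases hx : x ∈ S <;> simp [hS, hx]

/-- The two sets differ only by atoms of `p` that `q` does not charge, and these are countably many.
Diffuse parts of `q` and `p` can thus be compared on one common set. -/
lemma measure_nonatoms_of_le [IsFiniteMeasure p] (hqp : q ≤ p) :
    q {x | q {x} = 0} = q {x | p {x} = 0} := by
  refine le_antisymm ?_ (measure_mono fun x hx => le_antisymm ((hqp {x}).trans hx.le) bot_le)
  have hsub : {x | q {x} = 0} ⊆ {x | p {x} = 0} ∪ ({x | q {x} = 0} ∩ {x | p {x} ≠ 0}) := by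
    intro x hx
    by_cases h : p {x} = 0
    · exact Or.inl h
    · exact Or.inr ⟨hx, h⟩
  refine (measure_mono hsub).trans ((measure_union_le _ _).trans ?_)
  rw [measure_eq_zero_of_countable (S := {x | q {x} = 0} ∩ {x | p {x} ≠ 0})
    ((countable_atoms p).mono inter_subset_right) (fun x hx => hx.1), add_zero]

lemma ofReal_jump_mono (hK : CondK1 K) [IsFiniteMeasure p] (hqp : q ≤ p) (x : ℝ) :
    ENNReal.ofReal (K (q.real {x})) ≤ ENNReal.ofReal (K (p.real {x})) :=
  ENNReal.ofReal_le_ofReal (hK.mono measureReal_nonneg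
    (ENNReal.toReal_mono (measure_ne_top p _) (hqp {x})))

lemma jumpEnergy_univ_mono (hK : CondK1 K) [IsFiniteMeasure p] (hqp : q ≤ p) :
    jumpEnergy K q univ ≤ jumpEnergy K p univ := by
  rw [jumpEnergy_apply MeasurableSet.univ, jumpEnergy_apply MeasurableSet.univ]
  simp only [univ_inter, indicator_univ]
  rw [measure_nonatoms_of_le hqp]
  exact add_le_add (hqp _) (ENNReal.tsum_le_tsum (ofReal_jump_mono hK hqp))

/-- The diffuse mass and the sum over atoms are each monotone, so with finite energy neither can
drop. Strict monotonicity of `K` then makes the atoms agree one by one, hence also the total masses,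
which suffices because `q ≤ p`. -/
lemma eq_of_jumpEnergy_univ_le (hK : CondK1 K) [IsFiniteMeasure p] (hqp : q ≤ p)
    (hle : jumpEnergy K p univ ≤ jumpEnergy K q univ) (hfin : jumpEnergy K p univ ≠ ⊤) :
    q = p := by
  have : IsFiniteMeasure q := isFiniteMeasure_of_le p hqp
  rw [jumpEnergy_apply MeasurableSet.univ] at hle hfin
  rw [jumpEnergy_apply MeasurableSet.univ] at hle
  simp only [univ_inter, indicator_univ] at hle hfin
  rw [measure_nonatoms_of_le hqp] at hle
  have h1 := hqp {x | p {x} = 0}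
  have h2 := ENNReal.tsum_le_tsum (ofReal_jump_mono hK hqp)
  obtain ⟨hf1, hf2⟩ := ENNReal.add_ne_top.1 hfin
  have e1 : q {x | p {x} = 0} = p {x | p {x} = 0} := by
    refine le_antisymm h1 ?_
    by_contra! hlt
    exact absurd (hle.trans_lt (ENNReal.add_lt_add_of_lt_of_le
      (ne_top_of_le_ne_top hf2 h2) hlt h2)) (lt_irrefl _)
  have e2 : ∀ x, q {x} = p {x} := by
    intro x
    by_contra hne
    have hlt : q.real {x} < p.real {x} :=
      (ENNReal.toReal_lt_toReal (measure_ne_top _ _) (measure_ne_top _ _)).2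
        (lt_of_le_of_ne (hqp _) hne)
    have hKlt : K (q.real {x}) < K (p.real {x}) :=
      hK.2.1 (mem_Ici.2 measureReal_nonneg) (mem_Ici.2 measureReal_nonneg) hlt
    have hs := ENNReal.tsum_lt_tsum (ne_top_of_le_ne_top hf2 h2) (ofReal_jump_mono hK hqp)
      ((ENNReal.ofReal_lt_ofReal_iff ((hK.nonneg measureReal_nonneg).trans_lt hKlt)).2 hKlt)
    exact absurd (hle.trans_lt (ENNReal.add_lt_add_of_le_of_lt
      (ne_top_of_le_ne_top hf1 h1) h1 hs)) (lt_irrefl _)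
  refine Measure.eq_of_le_of_measure_univ_eq hqp ?_
  have hm := measurableSet_nonatoms p
  rw [← measure_add_measure_compl (μ := q) hm, ← measure_add_measure_compl (μ := p) hm, e1]
  congr 1
  have hc : {x | p {x} = 0}ᶜ.Countable := countable_atoms p
  rw [← biUnion_of_singleton {x | p {x} = 0}ᶜ,
    measure_biUnion hc (fun x _ y _ hxy => by simpa using hxy)
      (fun x _ => measurableSet_singleton x),
    measure_biUnion hc (fun x _ y _ hxy => by simpa using hxy)
      (fun x _ => measurableSet_singleton x)]
  exact tsum_congr fun x => e2 x

lemma jump_finset_le (hK1 : CondK1 K) (hK2 : CondK2 K) [IsFiniteMeasure p] (s : Finset ℝ) :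
    K (p.real s) ≤ ∑ x ∈ s, K (p.real {x}) := by
  induction s using Finset.induction_on with
  | empty => simp [hK1.2.2]
  | insert x s hx ih =>
    rw [Finset.sum_insert hx, Finset.coe_insert, insert_eq,
      measureReal_union (by simpa using hx) s.measurableSet]
    exact (hK2.subadditive measureReal_nonneg measureReal_nonneg).trans (by linarith)

/-- Merging all the variation in `S` into one jump does not increase the energy. -/
lemma ofReal_jump_le_jumpEnergy (hK1 : CondK1 K) (hK2 : CondK2 K) (hK3 : CondK3 K)
    [IsFiniteMeasure p] {S : Set ℝ} (hS : MeasurableSet S) :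
    ENNReal.ofReal (K (p.real S)) ≤ jumpEnergy K p S := by
  classical
  rw [jumpEnergy_apply hS]
  set D := {x | p {x} = 0} with hD
  have hDm : MeasurableSet D := measurableSet_nonatoms p
  have hc : (S ∩ Dᶜ).Countable := (countable_atoms p).mono inter_subset_right
  have hatoms : ∑' x, (S ∩ Dᶜ).indicator (fun x => p {x}) x = p (S ∩ Dᶜ) := by
    conv_rhs => rw [← biUnion_of_singleton (S ∩ Dᶜ)]
    rw [measure_biUnion hc (fun x _ y _ hxy => by simpa using hxy)
      (fun x _ => measurableSet_singleton x), tsum_subtype (S ∩ Dᶜ) (fun x => p {x})]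
  -- Only finitely many atoms `t` are treated by subadditivity of `K`; the rest of `S` is estimated
  -- by `K r ≤ r`. Adding `p t` to both sides avoids subtraction, and the supremum over finite sets
  -- recovers all atoms before cancelling.
  have key : ∀ s : Finset ℝ, ENNReal.ofReal (K (p.real S)) + ∑ x ∈ s,
      (S ∩ Dᶜ).indicator (fun x => p {x}) x ≤ p (S ∩ D) + (∑' x, S.indicator
      (fun x => ENNReal.ofReal (K (p.real {x}))) x) + p (S ∩ Dᶜ) := by
    intro s
    set t := s.filter (· ∈ S ∩ Dᶜ) with ht
    have htS : (t : Set ℝ) ⊆ S ∩ Dᶜ := fun x hx => (Finset.mem_filter.1 hx).2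
    have e1 : ∑ x ∈ s, (S ∩ Dᶜ).indicator (fun x => p {x}) x = p t := by
      rw [← sum_measure_singleton, ht, Finset.sum_filter]
      exact Finset.sum_congr rfl fun x _ => by simp [indicator_apply]
    have e2 : p S = p t + p (S \ t) := by
      rw [← measure_inter_add_sdiff S t.measurableSet,
        inter_eq_self_of_subset_right (htS.trans inter_subset_left)]
    have e3 : p (S \ t) + p t = p (S ∩ D) + p (S ∩ Dᶜ) := by
      rw [add_comm, ← e2, ← measure_inter_add_sdiff S hDm, sdiff_eq]
    have h4 : K (p.real S) ≤ (∑ x ∈ t, K (p.real {x})) + p.real (S \ t) := by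
      have : p.real S = p.real t + p.real (S \ t) := by
        rw [measureReal_def, e2, ENNReal.toReal_add (measure_ne_top _ _) (measure_ne_top _ _)]
        rfl
      rw [this]
      exact (hK2.subadditive measureReal_nonneg measureReal_nonneg).trans
        (add_le_add (jump_finset_le hK1 hK2 t) (hK2.le_self hK1 hK3 measureReal_nonneg))
    have h5 : ENNReal.ofReal (∑ x ∈ t, K (p.real {x})) ≤
        ∑' x, S.indicator (fun x => ENNReal.ofReal (K (p.real {x}))) x := by
      rw [ENNReal.ofReal_sum_of_nonneg fun x _ => hK1.nonneg measureReal_nonneg]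
      refine le_trans (le_of_eq (Finset.sum_congr rfl fun x hx => ?_)) (ENNReal.sum_le_tsum t)
      rw [indicator_of_mem (htS hx).1]
    rw [e1]
    calc _ ≤ ENNReal.ofReal (∑ x ∈ t, K (p.real {x})) + p (S \ t) + p t := by
          gcongr
          refine (ENNReal.ofReal_le_ofReal h4).trans ?_
          refine ENNReal.ofReal_add_le.trans ?_
          rw [ofReal_measureReal]
      _ ≤ _ := by
          rw [add_assoc, e3, ← add_assoc, add_comm (p (S ∩ D))]
          gcongr
  have h6 : ENNReal.ofReal (K (p.real S)) + p (S ∩ Dᶜ) ≤ p (S ∩ D) + (∑' x, S.indicator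
      (fun x => ENNReal.ofReal (K (p.real {x}))) x) + p (S ∩ Dᶜ) := by
    rw [← hatoms, ENNReal.tsum_eq_iSup_sum (f := (S ∩ Dᶜ).indicator fun x => p {x}),
      ENNReal.add_iSup]
    refine iSup_le fun s => ?_
    rw [← ENNReal.tsum_eq_iSup_sum (f := (S ∩ Dᶜ).indicator fun x => p {x}), hatoms]
    exact key s
  exact (ENNReal.add_le_add_iff_right (measure_ne_top p _)).1 h6

/-- The measure obtained from `p` by merging all the mass in `S` into an atom at `z`. -/
noncomputable def mergeAt (p : Measure ℝ) (S : Set ℝ) (z : ℝ) : Measure ℝ :=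
  p.restrict Sᶜ + p S • Measure.dirac z

/-- Off `S` the measure is unchanged; inside `S` nothing remains but the mass `p S` at `z`. -/
lemma jumpEnergy_mergeAt_le (hK : CondK1 K) [IsFiniteMeasure p] {S : Set ℝ}
    (hS : MeasurableSet S) {z : ℝ} (hz : z ∈ S) :
    jumpEnergy K (mergeAt p S z) univ ≤ jumpEnergy K p Sᶜ + ENNReal.ofReal (K (p.real S)) := by
  have happ : ∀ T, MeasurableSet T → mergeAt p S z T = p (T ∩ Sᶜ) + p S * T.indicator 1 z := by
    intro T hT
    rw [mergeAt, Measure.add_apply, Measure.restrict_apply hT, Measure.smul_apply,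
      Measure.dirac_apply' _ hT, smul_eq_mul]
  have hout : ∀ x ∈ Sᶜ, mergeAt p S z {x} = p {x} := by
    intro x hx
    have hne : z ≠ x := fun h => hx (h ▸ hz)
    rw [happ _ (measurableSet_singleton x),
      inter_eq_self_of_subset_left (singleton_subset_iff.2 hx)]
    simp [hne]
  have hin : ∀ x ∈ S, x ≠ z → mergeAt p S z {x} = 0 := by
    intro x hx hne
    rw [happ _ (measurableSet_singleton x)]
    have : {x} ∩ Sᶜ = (∅ : Set ℝ) := by
      ext y; simp only [mem_inter_iff, mem_singleton_iff, mem_compl_iff, mem_empty_iff_false,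
        iff_false, not_and, not_not]
      rintro rfl; exact hx
    rw [this]
    simp [hne.symm]
  have hzz : mergeAt p S z {z} = p S := by
    rw [happ _ (measurableSet_singleton z)]
    have : {z} ∩ Sᶜ = (∅ : Set ℝ) := by
      ext y; simp only [mem_inter_iff, mem_singleton_iff, mem_compl_iff, mem_empty_iff_false,
        iff_false, not_and, not_not]
      rintro rfl; exact hz
    rw [this]
    simp
  have : IsFiniteMeasure (mergeAt p S z) := by
    constructor
    rw [happ _ MeasurableSet.univ]
    simp
  have hm := measurableSet_nonatoms (mergeAt p S z)
  rw [← measure_add_measure_compl hS, add_comm]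
  refine add_le_add (le_of_eq ?_) ?_
  · rw [jumpEnergy_apply hS.compl, jumpEnergy_apply hS.compl]
    congr 1
    · have e : Sᶜ ∩ {x | mergeAt p S z {x} = 0} = Sᶜ ∩ {x | p {x} = 0} := by
        ext x
        refine and_congr_right fun hx => ?_
        rw [mem_ofPred_eq, mem_ofPred_eq, hout x hx]
      have hzT : z ∉ Sᶜ ∩ {x | p {x} = 0} := fun h => h.1 hz
      rw [e, happ _ (hS.compl.inter (measurableSet_nonatoms p)), indicator_of_notMem hzT, mul_zero,
        add_zero, inter_eq_self_of_subset_left inter_subset_left]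
    · refine tsum_congr fun x => ?_
      by_cases hx : x ∈ Sᶜ
      · rw [indicator_of_mem hx, indicator_of_mem hx, measureReal_def, hout x hx, measureReal_def]
      · rw [indicator_of_notMem hx, indicator_of_notMem hx]
  · rw [jumpEnergy_apply hS, happ _ (hS.inter hm)]
    have e : S ∩ {x | mergeAt p S z {x} = 0} ∩ Sᶜ = ∅ := by
      rw [inter_right_comm, inter_compl_self, empty_inter]
    have e2 : p S * (S ∩ {x | mergeAt p S z {x} = 0}).indicator 1 z = 0 := by
      by_cases h0 : p S = 0
      · rw [h0, zero_mul]
      · rw [indicator_of_notMem, mul_zero]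
        rintro ⟨-, h⟩
        exact h0 (hzz.symm.trans h)
    rw [e, e2, measure_empty, add_zero, zero_add, tsum_eq_single z]
    · rw [indicator_of_mem hz, measureReal_def, hzz, measureReal_def]
    · intro x hx
      by_cases hxS : x ∈ S
      · rw [indicator_of_mem hxS, measureReal_def, hin x hxS hx]
        simp [hK.2.2]
      · rw [indicator_of_notMem hxS]

end JumpEnergy

/-! ### Functions with vanishing distributional derivative -/

section DuBoisReymond

/-- A test function on `(a,b)` with zero integral is the derivative of a test function. -/
lemma exists_primitive_test {a b : ℝ} {χ : ℝ → ℝ} (hχ : ContDiff ℝ ∞ χ) {s t : ℝ}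
    (has : a < s) (htb : t < b) (hsupp : ∀ x, x ∉ Icc s t → χ x = 0)
    (hint : ∫ x, χ x = 0) :
    ∃ φ : ℝ → ℝ, ContDiff ℝ ∞ φ ∧ HasCompactSupport φ ∧ tsupport φ ⊆ Ioo a b ∧ deriv φ = χ := by
  have hderiv : ∀ x, HasDerivAt (fun x => ∫ y in a..x, χ y) (χ x) x := fun x =>
    intervalIntegral.integral_hasDerivAt_right (hχ.continuous.intervalIntegrable _ _)
      (hχ.continuous.stronglyMeasurableAtFilter _ _) hχ.continuous.continuousAt
  have hd : deriv (fun x => ∫ y in a..x, χ y) = χ := funext fun x => (hderiv x).deriv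
  have hzero : ∀ x, x ∉ Icc s t → ∫ y in a..x, χ y = 0 := by
    intro x hx
    rcases lt_or_ge x s with h | h
    · rw [intervalIntegral.integral_congr (g := fun _ => (0 : ℝ))]
      · simp
      · intro y hy
        refine hsupp y fun hy' => ?_
        have := hy.2
        exact absurd (hy'.1.trans hy.2) (not_le.2 (max_lt has h))
    · have hxt : t < x := by
        by_contra! h'
        exact hx ⟨h, h'⟩
      rw [intervalIntegral.integral_eq_integral_of_support_subset, hint]
      intro y hy
      have : y ∈ Icc s t := by
        by_contra hy'
        exact hy (hsupp y hy')
      exact ⟨has.trans_le this.1, this.2.trans hxt.le⟩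
  have hsub : tsupport (fun x => ∫ y in a..x, χ y) ⊆ Icc s t := by
    refine closure_minimal (fun x hx => ?_) isClosed_Icc
    by_contra hx'
    exact hx (hzero x hx')
  refine ⟨fun x => ∫ y in a..x, χ y, ?_, ?_, ?_, hd⟩
  · rw [contDiff_infty_iff_deriv, hd]
    exact ⟨fun x => (hderiv x).differentiableAt, hχ⟩
  · exact isCompact_Icc.of_isClosed_subset (isClosed_tsupport _) hsub
  · exact hsub.trans fun x hx => ⟨has.trans_le hx.1, hx.2.trans_lt htb⟩

lemma setIntegral_mul_test {a b : ℝ} {w φ : ℝ → ℝ} (hφ : tsupport φ ⊆ Ioo a b) :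
    ∫ x in Ioo a b, w x * φ x = ∫ x, w x * φ x := by
  refine setIntegral_eq_integral_of_forall_compl_eq_zero fun x hx => ?_
  rw [image_eq_zero_of_notMem_tsupport fun h => hx (hφ h), mul_zero]

lemma integrableOn_mul_test {a b : ℝ} {w φ : ℝ → ℝ} (hw : IntegrableOn w (Ioo a b))
    (hφ : Continuous φ) (hc : HasCompactSupport φ) :
    IntegrableOn (fun x => w x * φ x) (Ioo a b) := by
  obtain ⟨C, hC⟩ := hc.exists_bound_of_continuous hφ
  exact Integrable.mul_bdd (c := C) hw hφ.aestronglyMeasurable (Eventually.of_forall hC)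

/-- The lemma of du Bois-Reymond. -/
lemma exists_ae_eq_const {a b : ℝ} (hab : a < b) {w : ℝ → ℝ} (hw : IntegrableOn w (Ioo a b))
    (h : ∀ φ : ℝ → ℝ, ContDiff ℝ ∞ φ → HasCompactSupport φ → tsupport φ ⊆ Ioo a b →
      ∫ x in Ioo a b, w x * deriv φ x = 0) :
    ∃ c, w =ᵐ[volume.restrict (Ioo a b)] fun _ => c := by
  set m := (a + b) / 2 with hm
  let f : ContDiffBump m := ⟨(b - a) / 8, (b - a) / 4, by linarith, by linarith⟩
  set η := f.normed volume with hη
  have hηs : tsupport η = Metric.closedBall m ((b - a) / 4) := f.tsupport_normed_eq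
  have hball : Metric.closedBall m ((b - a) / 4) ⊆ Ioo a b := by
    intro x hx
    rw [Real.closedBall_eq_Icc] at hx
    constructor
    · have := hx.1; rw [hm] at this; linarith
    · have := hx.2; rw [hm] at this; linarith
  have hηd : ContDiff ℝ ∞ η := f.contDiff_normed
  have hηc : HasCompactSupport η := f.hasCompactSupport_normed
  have hηint : ∫ x, η x = 1 := f.integral_normed
  -- The constant must be the mean of `w` against `η`: for any test function `ψ`, the function `ψ -
  -- (∫ ψ) η` has integral zero and so is the derivative of an admissible test function.
  set k := ∫ x in Ioo a b, w x * η x with hk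
  refine ⟨k, ?_⟩
  have key : ∀ᵐ x ∂volume, x ∈ Ioo a b → w x - k = 0 := by
    have hwk : IntegrableOn (fun x => w x - k) (Ioo a b) :=
      Integrable.sub hw (integrableOn_const (by simp))
    refine isOpen_Ioo.ae_eq_zero_of_integral_contDiff_smul_eq_zero
      hwk.locallyIntegrableOn fun ψ hψ hψc hψs => ?_
    have hψi : Integrable ψ := hψ.continuous.integrable_of_hasCompactSupport hψc
    have hηi : Integrable η := hηd.continuous.integrable_of_hasCompactSupport hηc
    set I := ∫ x, ψ x with hI
    set T := tsupport ψ ∪ Metric.closedBall m ((b - a) / 4) with hT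
    have hTc : IsCompact T := IsCompact.union hψc (isCompact_closedBall _ _)
    have hTs : T ⊆ Ioo a b := union_subset hψs hball
    have hTn : T.Nonempty := ⟨m, Or.inr (Metric.mem_closedBall_self (by linarith))⟩
    obtain ⟨s, hsT, hs⟩ := hTc.exists_isLeast hTn
    obtain ⟨t, htT, ht⟩ := hTc.exists_isGreatest hTn
    obtain ⟨φ, hφ, hφc, hφs, hφd⟩ := exists_primitive_test (a := a) (b := b)
      (χ := fun x => ψ x - I * η x) (hψ.sub (contDiff_const.mul hηd)) (hTs hsT).1
      (hTs htT).2 (fun x hx => by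
        have hxT : x ∉ T := fun h => hx ⟨hs h, ht h⟩
        have h1 : ψ x = 0 := image_eq_zero_of_notMem_tsupport fun h => hxT (Or.inl h)
        have h2 : η x = 0 := image_eq_zero_of_notMem_tsupport fun h => hxT (Or.inr (hηs ▸ h))
        simp [h1, h2])
      (by rw [integral_sub hψi (hηi.const_mul I), integral_const_mul, hηint, hI]; ring)
    have h0 := h φ hφ hφc hφs
    rw [hφd] at h0
    have e1 : ∀ x, w x * (ψ x - I * η x) = w x * ψ x - I * (w x * η x) := fun x => by ring
    simp_rw [e1] at h0
    rw [integral_sub (integrableOn_mul_test hw hψ.continuous hψc)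
      ((integrableOn_mul_test hw hηd.continuous hηc).const_mul I), integral_const_mul, ← hk] at h0
    have e2 : ∀ x, ψ x • (w x - k) = (w x - k) * ψ x := fun x => by
      rw [smul_eq_mul, mul_comm]
    simp_rw [e2]
    rw [← setIntegral_mul_test hψs]
    have e3 : ∀ x, (w x - k) * ψ x = w x * ψ x - k * ψ x := fun x => by ring
    simp_rw [e3]
    rw [integral_sub (integrableOn_mul_test hw hψ.continuous hψc)
      (hψi.integrableOn.const_mul k), integral_const_mul,
      setIntegral_eq_integral_of_forall_compl_eq_zero (fun x hx =>
        image_eq_zero_of_notMem_tsupport fun h => hx (hψs h))]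
    rw [← hI]
    linarith
  rw [EventuallyEq, ae_restrict_iff' measurableSet_Ioo]
  filter_upwards [key] with x hx hxm
  linarith [hx hxm]

end DuBoisReymond

/-! ### Distribution functions -/

section DistributionFunction

variable {p : Measure ℝ} [IsFiniteMeasure p]

lemma monotone_measureReal_Iic : Monotone fun x => p.real (Iic x) := fun _ _ h =>
  measureReal_mono (Iic_subset_Iic.2 h)

lemma measureReal_Iic_sub {x y : ℝ} (hxy : x ≤ y) :
    p.real (Iic y) - p.real (Iic x) = p.real (Ioc x y) := by
  rw [← Iic_union_Ioc_eq_Iic hxy, measureReal_union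
    (disjoint_left.2 fun z hz hz' => not_lt.2 (mem_Iic.1 hz) hz'.1) measurableSet_Ioc]
  ring

lemma tendsto_measureReal_Iic_right (x : ℝ) :
    Tendsto (fun y => p.real (Iic y)) (𝓝[>] x) (𝓝 (p.real (Iic x))) := by
  have h := tendsto_measure_biInter_gt (μ := p) (s := fun y : ℝ => Iic y) (a := x)
    (fun r _ => measurableSet_Iic.nullMeasurableSet) (fun i j _ hij => Iic_subset_Iic.2 hij)
    ⟨x + 1, by simp, measure_ne_top _ _⟩
  have e : ⋂ r > x, Iic r = Iic x := by
    ext y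
    simp only [mem_iInter, mem_Iic]
    exact ⟨fun h => le_of_forall_gt_imp_ge_of_dense h, fun h r hr => h.trans hr.le⟩
  rw [e] at h
  exact (ENNReal.tendsto_toReal (measure_ne_top _ _)).comp h

lemma tendsto_measureReal_Iic_left (x : ℝ) :
    Tendsto (fun y => p.real (Iic y)) (𝓝[<] x) (𝓝 (p.real (Iio x))) := by
  -- Continuity from above is applied to the complements, after the reflection `y ↦ -y` that turns
  -- the left limit into a right one.
  have h := tendsto_measure_biInter_gt (μ := p) (s := fun y : ℝ => Ioi (-y)) (a := -x)
    (fun r _ => measurableSet_Ioi.nullMeasurableSet)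
    (fun i j _ hij => Ioi_subset_Ioi (neg_le_neg hij)) ⟨-x + 1, by simp, measure_ne_top _ _⟩
  have e : ⋂ r > -x, Ioi (-r) = Ici x := by
    ext y
    simp only [mem_iInter, mem_Ioi, mem_Ici]
    constructor
    · intro h
      by_contra! hlt
      exact absurd (h (-y) (neg_lt_neg hlt)) (by simp)
    · intro h r hr
      linarith
  rw [e] at h
  have h2 := ((ENNReal.tendsto_toReal (measure_ne_top p (Ici x))).comp h).comp
    (tendsto_neg_nhdsLT (a := x))
  have h3 := h2.const_sub (p.real univ)
  have e1 : p.real univ - (p (Ici x)).toReal = p.real (Iio x) := by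
    rw [← measureReal_add_measureReal_compl (s := Iio x) measurableSet_Iio, compl_Iio,
      measureReal_def p (Ici x)]
    ring
  rw [e1] at h3
  refine h3.congr fun y => ?_
  rw [← measureReal_add_measureReal_compl (s := Iic y) measurableSet_Iic, compl_Iic]
  simp [measureReal_def]

lemma measureReal_Iio_add_singleton (x : ℝ) :
    p.real (Iio x) + p.real {x} = p.real (Iic x) := by
  rw [← Iio_union_right, measureReal_union (by simp) (measurableSet_singleton x)]

/-- Fubini: write `p (Iic x)` as the `p`-integral of the indicator of `t ≤ x`, then integrate `deriv
φ` over `[t,∞)`. -/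
lemma integral_measureReal_Iic_mul_deriv {φ : ℝ → ℝ} (hφ : ContDiff ℝ ∞ φ)
    (hc : HasCompactSupport φ) :
    ∫ x, p.real (Iic x) * deriv φ x = -∫ t, φ t ∂p := by
  have hφ1 : ContDiff ℝ 1 φ := hφ.of_le (by exact_mod_cast le_top)
  have hi : Integrable (deriv φ) :=
    (hφ1.continuous_deriv le_rfl).integrable_of_hasCompactSupport hc.deriv
  have e1 : ∀ x, p.real (Iic x) * deriv φ x =
      ∫ t, {q : ℝ × ℝ | q.2 ≤ q.1}.indicator (fun q => deriv φ q.1) (x, t) ∂p := by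
    intro x
    have : (fun t => {q : ℝ × ℝ | q.2 ≤ q.1}.indicator (fun q => deriv φ q.1) (x, t)) =
        (Iic x).indicator fun _ => deriv φ x := by
      ext t
      simp [indicator_apply]
    rw [this, integral_indicator measurableSet_Iic, setIntegral_const, smul_eq_mul]
  simp_rw [e1]
  have hm : MeasurableSet {q : ℝ × ℝ | q.2 ≤ q.1} := measurableSet_le measurable_snd measurable_fst
  have hint : Integrable (Function.uncurry fun x t =>
      {q : ℝ × ℝ | q.2 ≤ q.1}.indicator (fun q => deriv φ q.1) (x, t))
      ((volume : Measure ℝ).prod p) := (hi.comp_fst p).indicator hm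
  rw [integral_integral_swap hint, ← integral_neg]
  refine integral_congr_ae (Eventually.of_forall fun t => ?_)
  have : (fun x => {q : ℝ × ℝ | q.2 ≤ q.1}.indicator (fun q => deriv φ q.1) (x, t)) =
      (Ici t).indicator (deriv φ) := by
    ext x
    simp [indicator_apply]
  simp only [this]
  rw [integral_indicator measurableSet_Ici, integral_Ici_eq_integral_Ioi]
  exact hc.integral_Ioi_deriv_eq hφ1 t

end DistributionFunction

/-! ### The right-continuous representative of a function of bounded variation -/

section Representative

/-- The function `c + μ(-∞,x]`, where `μ` is the signed measure with Jordan decomposition `j`. -/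
noncomputable def bvRep (j : JordanDecomposition ℝ) (c x : ℝ) : ℝ :=
  c + (j.posPart.real (Iic x) - j.negPart.real (Iic x))

lemma totalVariation_toSignedMeasure (j : JordanDecomposition ℝ) :
    j.toSignedMeasure.totalVariation = j.posPart + j.negPart := by
  rw [SignedMeasure.totalVariation, JordanDecomposition.toJordanDecomposition_toSignedMeasure]

lemma bvRep_integrableOn (j : JordanDecomposition ℝ) (c a b : ℝ) :
    IntegrableOn (bvRep j c) (Ioo a b) := by
  have h : ∀ p : Measure ℝ, [IsFiniteMeasure p] →
      IntegrableOn (fun x => p.real (Iic x)) (Ioo a b) := fun p _ =>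
    ((monotone_measureReal_Iic.monotoneOn _).integrableOn_isCompact isCompact_Icc).mono_set
      Ioo_subset_Icc_self
  exact (integrableOn_const (by simp)).add ((h j.posPart).sub (h j.negPart))

lemma integral_bvRep_mul_deriv (j : JordanDecomposition ℝ) (c : ℝ) {a b : ℝ} {φ : ℝ → ℝ}
    (hφ : ContDiff ℝ ∞ φ) (hc : HasCompactSupport φ) (hs : tsupport φ ⊆ Ioo a b) :
    ∫ x in Ioo a b, bvRep j c x * deriv φ x = -((∫ x, φ x ∂j.posPart) - ∫ x, φ x ∂j.negPart) := by
  have hφ1 : ContDiff ℝ 1 φ := hφ.of_le (by exact_mod_cast le_top)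
  have hcont : Continuous (deriv φ) := hφ1.continuous_deriv le_rfl
  have hi : Integrable (deriv φ) := hcont.integrable_of_hasCompactSupport hc.deriv
  have hφi : Integrable φ := hφ.continuous.integrable_of_hasCompactSupport hc
  have h0 : ∫ x, deriv φ x = 0 := integral_eq_zero_of_hasDerivAt_of_integrable
    (fun x => (hφ1.differentiable one_ne_zero x).hasDerivAt) hi hφi
  have hp : ∀ p : Measure ℝ, [IsFiniteMeasure p] →
      Integrable (fun x => p.real (Iic x) * deriv φ x) := fun p _ =>
    Integrable.bdd_mul (c := p.real univ) hi
      monotone_measureReal_Iic.measurable.aestronglyMeasurable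
      (Eventually.of_forall fun x => by
        rw [Real.norm_of_nonneg measureReal_nonneg]
        exact measureReal_mono (subset_univ _))
  rw [setIntegral_mul_test ((tsupport_deriv_subset).trans hs)]
  have e : ∀ x, bvRep j c x * deriv φ x = c * deriv φ x +
      (j.posPart.real (Iic x) * deriv φ x - j.negPart.real (Iic x) * deriv φ x) := fun x => by
    rw [bvRep]; ring
  simp_rw [e]
  have hpn : Integrable (fun x => j.posPart.real (Iic x) * deriv φ x -
      j.negPart.real (Iic x) * deriv φ x) := (hp _).sub (hp _)
  rw [integral_add (hi.const_mul c) hpn, integral_const_mul, h0,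
    integral_sub (hp _) (hp _), integral_measureReal_Iic_mul_deriv hφ hc,
    integral_measureReal_Iic_mul_deriv hφ hc]
  ring

lemma isDistribDeriv_of_ae_eq_bvRep {a b : ℝ} {u : ℝ → ℝ} {j : JordanDecomposition ℝ} {c : ℝ}
    (hj : (j.posPart + j.negPart) (Ioo a b)ᶜ = 0)
    (hu : u =ᵐ[volume.restrict (Ioo a b)] bvRep j c) :
    IsDistribDeriv a b u j.toSignedMeasure := by
  refine ⟨by rwa [totalVariation_toSignedMeasure], fun φ hφ hc hs => ?_⟩
  rw [JordanDecomposition.toJordanDecomposition_toSignedMeasure,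
    ← integral_bvRep_mul_deriv j c hφ hc hs]
  refine integral_congr_ae ?_
  filter_upwards [hu] with x hx
  rw [hx]

lemma memBV_of_ae_eq_bvRep {a b : ℝ} {u : ℝ → ℝ} {j : JordanDecomposition ℝ} {c : ℝ}
    (hj : (j.posPart + j.negPart) (Ioo a b)ᶜ = 0)
    (hu : u =ᵐ[volume.restrict (Ioo a b)] bvRep j c) : MemBV a b u :=
  ⟨(bvRep_integrableOn j c a b).congr hu.symm, _, isDistribDeriv_of_ae_eq_bvRep hj hu⟩

/-- The distribution function of `μ` has the same distributional derivative as `u`, so du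
Bois-Reymond applies to the difference. -/
lemma IsDistribDeriv.exists_ae_eq_bvRep {a b : ℝ} (hab : a < b) {u : ℝ → ℝ} {μ : SignedMeasure ℝ}
    (hu : IntegrableOn u (Ioo a b)) (h : IsDistribDeriv a b u μ) :
    ∃ c, u =ᵐ[volume.restrict (Ioo a b)] bvRep μ.toJordanDecomposition c := by
  set j := μ.toJordanDecomposition
  obtain ⟨c, hc⟩ := exists_ae_eq_const hab (w := fun x => u x - bvRep j 0 x)
    (hu.sub (bvRep_integrableOn j 0 a b)) (fun φ hφ hc hs => by
      have hcont : Continuous (deriv φ) :=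
        (hφ.of_le (by exact_mod_cast le_top) : ContDiff ℝ 1 φ).continuous_deriv le_rfl
      simp_rw [sub_mul]
      rw [integral_sub (integrableOn_mul_test hu hcont hc.deriv)
        (integrableOn_mul_test (bvRep_integrableOn j 0 a b) hcont hc.deriv), h.2 φ hφ hc hs,
        integral_bvRep_mul_deriv j 0 hφ hc hs, sub_self])
  refine ⟨c, ?_⟩
  filter_upwards [hc] with x hx
  rw [bvRep] at hx ⊢
  linarith

lemma MemBV.exists_bvRep {a b : ℝ} (hab : a < b) {u : ℝ → ℝ} (h : MemBV a b u) :
    ∃ j : JordanDecomposition ℝ, ∃ c, (j.posPart + j.negPart) (Ioo a b)ᶜ = 0 ∧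
      u =ᵐ[volume.restrict (Ioo a b)] bvRep j c := by
  obtain ⟨hu, μ, hμ⟩ := h
  obtain ⟨c, hc⟩ := hμ.exists_ae_eq_bvRep hab hu
  exact ⟨_, c, hμ.1, hc⟩

lemma tendsto_bvRep_right (j : JordanDecomposition ℝ) (c x : ℝ) :
    Tendsto (bvRep j c) (𝓝[>] x) (𝓝 (bvRep j c x)) :=
  ((tendsto_measureReal_Iic_right x).sub (tendsto_measureReal_Iic_right x)).const_add c

lemma tendsto_bvRep_left (j : JordanDecomposition ℝ) (c x : ℝ) :
    Tendsto (bvRep j c) (𝓝[<] x)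
      (𝓝 (bvRep j c x - (j.posPart.real {x} - j.negPart.real {x}))) := by
  have h := ((tendsto_measureReal_Iic_left (p := j.posPart) x).sub
    (tendsto_measureReal_Iic_left (p := j.negPart) x)).const_add c
  convert! h using 2
  rw [bvRep, ← measureReal_Iio_add_singleton x, ← measureReal_Iio_add_singleton x]
  ring

/-- Right-continuous functions agreeing a.e. on `(a,b)` agree on `[a,b)`. -/
lemma eq_of_ae_eq_of_tendsto_right {a b : ℝ} {v w : ℝ → ℝ}
    (hvw : v =ᵐ[volume.restrict (Ioo a b)] w) {x : ℝ} (hx : x ∈ Ico a b)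
    (hv : Tendsto v (𝓝[>] x) (𝓝 (v x))) (hw : Tendsto w (𝓝[>] x) (𝓝 (w x))) : v x = w x := by
  rw [EventuallyEq, ae_restrict_iff' measurableSet_Ioo] at hvw
  have hfreq : ∃ᶠ y in 𝓝[>] x, v y = w y := by
    intro hne
    obtain ⟨z, hz, hzs⟩ := mem_nhdsGT_iff_exists_Ioo_subset.1 hne
    have hnull : volume (Ioo x (min z b)) = 0 := by
      refine measure_mono_null (fun y hy => ?_) hvw
      have h1 : ¬ v y = w y := hzs ⟨hy.1, hy.2.trans_le (min_le_left _ _)⟩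
      exact fun h => h1 (h ⟨hx.1.trans_lt hy.1, hy.2.trans_le (min_le_right _ _)⟩)
    rw [Real.volume_Ioo, ENNReal.ofReal_eq_zero, sub_nonpos] at hnull
    exact absurd hnull (not_le.2 (lt_min hz hx.2))
  by_contra hne
  have h0 := (hv.sub hw).eventually_ne (sub_ne_zero.2 hne)
  obtain ⟨y, h1, h2⟩ := (hfreq.and_eventually h0).exists
  exact h2 (sub_eq_zero.2 h1)

lemma bvRep_sub_of_le (j : JordanDecomposition ℝ) (c : ℝ) {x y : ℝ} (hxy : x ≤ y) :
    bvRep j c y - bvRep j c x = j.posPart.real (Ioc x y) - j.negPart.real (Ioc x y) := by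
  rw [← measureReal_Iic_sub hxy, ← measureReal_Iic_sub hxy, bvRep, bvRep]
  ring

lemma toSignedMeasure_apply_eq (j : JordanDecomposition ℝ) {S : Set ℝ} (hS : MeasurableSet S) :
    j.toSignedMeasure S = j.posPart.real S - j.negPart.real S := by
  rw [SignedMeasure.apply_eq_posPart_real_sub_negPart_real _ hS,
    JordanDecomposition.toJordanDecomposition_toSignedMeasure]

/-- The representing Jordan decomposition is unique. -/
lemma jordanDecomposition_eq_of_bvRep_ae_eq {a b : ℝ} {i j : JordanDecomposition ℝ} {c d : ℝ}
    (hi : (i.posPart + i.negPart) (Ioo a b)ᶜ = 0) (hj : (j.posPart + j.negPart) (Ioo a b)ᶜ = 0)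
    (h : bvRep i c =ᵐ[volume.restrict (Ioo a b)] bvRep j d) : i = j := by
  simp only [Measure.add_apply, add_eq_zero] at hi hj
  have hco : ∀ x ∈ Ico a b, bvRep i c x = bvRep j d x := fun x hx =>
    eq_of_ae_eq_of_tendsto_right h hx (tendsto_bvRep_right i c x) (tendsto_bvRep_right j d x)
  have hlt : ∀ (p : Measure ℝ), p (Ioo a b)ᶜ = 0 → ∀ x < a, p (Iic x) = 0 ∧ p (Iic a) = 0 :=
    fun p hp x hx => 
      ⟨measure_mono_null (t := (Ioo a b)ᶜ) (fun y hy hy' =>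
        absurd (hy'.1.trans_le ((mem_Iic.1 hy).trans hx.le)) (lt_irrefl _)) hp,
      measure_mono_null (t := (Ioo a b)ᶜ) (fun y hy hy' =>
        absurd (hy'.1.trans_le (mem_Iic.1 hy)) (lt_irrefl _)) hp⟩
  refine JordanDecomposition.toSignedMeasure_injective ?_
  -- Rearranged without differences, the claim concerns finite positive measures, which are
  -- determined by half-lines. Below `b` the representatives decide; from `b` on, a left limit at
  -- `b` does.
  have hfin : i.posPart + j.negPart = j.posPart + i.negPart := by
    refine Measure.ext_of_Iic _ _ fun x => ?_
    have hle : ∀ y, y < b → (i.posPart + j.negPart) (Iic y) = (j.posPart + i.negPart) (Iic y) := by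
      intro y hyb
      rcases lt_or_ge y a with hya | hya
      · simp [(hlt _ hi.1 y hya).1, (hlt _ hj.2 y hya).1, (hlt _ hj.1 y hya).1,
          (hlt _ hi.2 y hya).1]
      · have h1 := hco y ⟨hya, hyb⟩
        have h2 := hco a ⟨le_rfl, hya.trans_lt hyb⟩
        have hreal : ∀ p : Measure ℝ, p (Ioo a b)ᶜ = 0 → p.real (Iic a) = 0 := fun p hp => by
          rw [measureReal_def, (hlt p hp (a - 1) (by linarith)).2, ENNReal.toReal_zero]
        simp only [bvRep, hreal _ hi.1, hreal _ hi.2, hreal _ hj.1, hreal _ hj.2] at h1 h2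
        rw [← ENNReal.toReal_eq_toReal_iff' (measure_ne_top _ _) (measure_ne_top _ _)]
        change (i.posPart + j.negPart).real (Iic y) = (j.posPart + i.negPart).real (Iic y)
        rw [measureReal_add_apply, measureReal_add_apply]
        linarith
    rcases lt_or_ge x b with hx | hx
    · exact hle x hx
    · have hIio : (i.posPart + j.negPart) (Iio b) = (j.posPart + i.negPart) (Iio b) := by
        have h1 := tendsto_measureReal_Iic_left (p := i.posPart + j.negPart) b
        have h2 := tendsto_measureReal_Iic_left (p := j.posPart + i.negPart) b
        have h3 := tendsto_nhds_unique (h1.congr' (f₂ := fun y =>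
          (j.posPart + i.negPart).real (Iic y)) (by
            filter_upwards [self_mem_nhdsWithin] with y hy
            rw [measureReal_def, hle y hy, measureReal_def])) h2
        exact (ENNReal.toReal_eq_toReal_iff' (measure_ne_top _ _) (measure_ne_top _ _)).1 h3
      have hd : ∀ p : Measure ℝ, p (Ioo a b)ᶜ = 0 → p (Iic x) = p (Iio b) := by
        intro p hp
        refine le_antisymm ?_ (measure_mono fun y hy => (mem_Iio.1 hy).le.trans hx)
        calc p (Iic x) ≤ p (Iio b ∪ (Ioo a b)ᶜ) := measure_mono fun y _ => by
              by_cases hy : y < b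
              · exact Or.inl hy
              · exact Or.inr fun h => hy h.2
          _ ≤ p (Iio b) + p (Ioo a b)ᶜ := measure_union_le _ _
          _ = p (Iio b) := by rw [hp, add_zero]
      rw [hd _ (by simp [hi.1, hj.2]), hd _ (by simp [hi.2, hj.1]), hIio]
  ext S hS
  rw [toSignedMeasure_apply_eq _ hS, toSignedMeasure_apply_eq _ hS]
  have : (i.posPart + j.negPart).real S = (j.posPart + i.negPart).real S := by rw [hfin]
  rw [measureReal_add_apply, measureReal_add_apply] at this
  linarith

/-- `distribDeriv` is defined by choice; uniqueness of the representing measure makes the choice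
irrelevant. -/
lemma distribDeriv_eq {a b : ℝ} (hab : a < b) {u : ℝ → ℝ} {j : JordanDecomposition ℝ} {c : ℝ}
    (hj : (j.posPart + j.negPart) (Ioo a b)ᶜ = 0)
    (hu : u =ᵐ[volume.restrict (Ioo a b)] bvRep j c) :
    distribDeriv a b u = j.toSignedMeasure := by
  have hex : ∃ μ : SignedMeasure ℝ, IsDistribDeriv a b u μ :=
    ⟨_, isDistribDeriv_of_ae_eq_bvRep hj hu⟩
  rw [distribDeriv, dif_pos hex]
  obtain ⟨d, hd⟩ := hex.choose_spec.exists_ae_eq_bvRep hab (memBV_of_ae_eq_bvRep hj hu).1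
  rw [← jordanDecomposition_eq_of_bvRep_ae_eq hex.choose_spec.1 hj (hd.symm.trans hu),
    SignedMeasure.toSignedMeasure_toJordanDecomposition]

end Representative

/-! ### One-sided approximate limits -/

section ApproxLimits

/-- The family `s` is abstract so that left and right intervals are handled together. -/
lemma tendsto_average_of_eventually_ae_le {s : ℝ → Set ℝ} {u : ℝ → ℝ} {l : ℝ}
    (hs : ∀ r > 0, volume (s r) = ENNReal.ofReal r)
    (h : ∀ ε > 0, ∀ᶠ r in 𝓝[>] (0 : ℝ), ∀ᵐ y ∂volume.restrict (s r), |u y - l| ≤ ε) :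
    Tendsto (fun r => ⨍ y in s r, |u y - l|) (𝓝[>] 0) (𝓝 0) := by
  rw [Metric.tendsto_nhds]
  intro ε hε
  filter_upwards [h (ε / 2) (by positivity), self_mem_nhdsWithin] with r hr hr0
  have hr0 : 0 < r := hr0
  have hb := norm_setIntegral_le_of_norm_le_const_ae (f := fun y => |u y - l|) (μ := volume)
    (s := s r) (C := ε / 2) (by simp [hs r hr0]) (by simpa using hr)
  have hreal : volume.real (s r) = r := by
    rw [measureReal_def, hs r hr0, ENNReal.toReal_ofReal hr0.le]
  rw [hreal] at hb
  rw [dist_zero_right, setAverage_eq, hreal, norm_smul, norm_inv, Real.norm_of_nonneg hr0.le]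
  calc r⁻¹ * _ ≤ r⁻¹ * (ε / 2 * r) := by gcongr
    _ = ε / 2 := by field_simp
    _ < ε := by linarith

lemma eq_of_tendsto_average {s : ℝ → Set ℝ} {u : ℝ → ℝ} {l m : ℝ}
    (hs : ∀ r > 0, volume (s r) = ENNReal.ofReal r)
    (hu : ∀ᶠ r in 𝓝[>] (0 : ℝ), IntegrableOn u (s r))
    (hl : Tendsto (fun r => ⨍ y in s r, |u y - l|) (𝓝[>] 0) (𝓝 0))
    (hm : Tendsto (fun r => ⨍ y in s r, |u y - m|) (𝓝[>] 0) (𝓝 0)) : l = m := by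
  have h := hl.add hm
  rw [add_zero] at h
  have hle : |l - m| ≤ 0 := by
    refine ge_of_tendsto h ?_
    filter_upwards [hu, self_mem_nhdsWithin] with r hr hr0
    have hr0 : 0 < r := hr0
    have hreal : volume.real (s r) = r := by
      rw [measureReal_def, hs r hr0, ENNReal.toReal_ofReal hr0.le]
    have hc : ∀ c : ℝ, IntegrableOn (fun _ => c) (s r) := fun c =>
      integrableOn_const (by simp [hs r hr0])
    have hi : ∀ c : ℝ, IntegrableOn (fun y => |u y - c|) (s r) := fun c => (hr.sub (hc c)).abs
    rw [setAverage_eq, setAverage_eq, hreal, ← smul_add, ← integral_add (hi l) (hi m)]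
    have : ∫ _ in s r, |l - m| ≤ ∫ y in s r, (|u y - l| + |u y - m|) := by
      refine integral_mono (hc _) ((hi l).add (hi m)) fun y => ?_
      rw [abs_sub_comm (u y) l]
      exact abs_sub_le l (u y) m
    rw [setIntegral_const, hreal, smul_eq_mul] at this
    rw [smul_eq_mul]
    calc |l - m| = r⁻¹ * (r * |l - m|) := by field_simp
      _ ≤ _ := by gcongr
  exact sub_eq_zero.1 (abs_nonpos_iff.1 hle)

variable {a b x l : ℝ} {u F : ℝ → ℝ}

lemma volume_Ioo_left (x : ℝ) : ∀ r > 0, volume (Ioo (x - r) x) = ENNReal.ofReal r := by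
  intro r _
  rw [Real.volume_Ioo, sub_sub_cancel]

lemma volume_Ioo_right (x : ℝ) : ∀ r > 0, volume (Ioo x (x + r)) = ENNReal.ofReal r := by
  intro r _
  rw [Real.volume_Ioo, add_sub_cancel_left]

lemma eventually_Ioo_left_subset (hx : a < x) :
    ∀ᶠ r in 𝓝[>] (0 : ℝ), Ioo (x - r) x ⊆ Ioo a x := by
  filter_upwards [Ioo_mem_nhdsGT (sub_pos.2 hx)] with r hr
  exact Ioo_subset_Ioo_left (by linarith [hr.2])

lemma eventually_Ioo_right_subset (hx : x < b) :
    ∀ᶠ r in 𝓝[>] (0 : ℝ), Ioo x (x + r) ⊆ Ioo x b := by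
  filter_upwards [Ioo_mem_nhdsGT (sub_pos.2 hx)] with r hr
  exact Ioo_subset_Ioo_right (by linarith [hr.2])

lemma isApproxLeftLim_of_tendsto (hx : x ∈ Ioo a b) (hu : u =ᵐ[volume.restrict (Ioo a b)] F)
    (hF : Tendsto F (𝓝[<] x) (𝓝 l)) : IsApproxLeftLim u x l := by
  refine tendsto_average_of_eventually_ae_le (volume_Ioo_left x) fun ε hε => ?_
  obtain ⟨z, hz, hzs⟩ := mem_nhdsLT_iff_exists_Ioo_subset.1
    (Metric.tendsto_nhds.1 hF ε hε)
  filter_upwards [eventually_Ioo_left_subset hx.1, eventually_Ioo_left_subset hz] with r h1 h2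
  have h3 := ae_restrict_of_ae_restrict_of_subset (h1.trans (Ioo_subset_Ioo_right hx.2.le)) hu
  filter_upwards [h3, ae_restrict_mem measurableSet_Ioo] with y hy hyr
  rw [hy]
  exact (hzs (h2 hyr)).le

lemma isApproxRightLim_of_tendsto (hx : x ∈ Ioo a b) (hu : u =ᵐ[volume.restrict (Ioo a b)] F)
    (hF : Tendsto F (𝓝[>] x) (𝓝 l)) : IsApproxRightLim u x l := by
  refine tendsto_average_of_eventually_ae_le (volume_Ioo_right x) fun ε hε => ?_
  obtain ⟨z, hz, hzs⟩ := mem_nhdsGT_iff_exists_Ioo_subset.1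
    (Metric.tendsto_nhds.1 hF ε hε)
  filter_upwards [eventually_Ioo_right_subset hx.2, eventually_Ioo_right_subset hz] with r h1 h2
  have h3 := ae_restrict_of_ae_restrict_of_subset (h1.trans (Ioo_subset_Ioo_left hx.1.le)) hu
  filter_upwards [h3, ae_restrict_mem measurableSet_Ioo] with y hy hyr
  rw [hy]
  exact (hzs (h2 hyr)).le

lemma IsApproxLeftLim.eq (hx : x ∈ Ioo a b) (hu : IntegrableOn u (Ioo a b)) {m : ℝ}
    (hl : IsApproxLeftLim u x l) (hm : IsApproxLeftLim u x m) : l = m := by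
  refine eq_of_tendsto_average (volume_Ioo_left x) ?_ hl hm
  filter_upwards [eventually_Ioo_left_subset hx.1] with r hr
  exact hu.mono_set (hr.trans (Ioo_subset_Ioo_right hx.2.le))

lemma IsApproxRightLim.eq (hx : x ∈ Ioo a b) (hu : IntegrableOn u (Ioo a b)) {m : ℝ}
    (hl : IsApproxRightLim u x l) (hm : IsApproxRightLim u x m) : l = m := by
  refine eq_of_tendsto_average (volume_Ioo_right x) ?_ hl hm
  filter_upwards [eventually_Ioo_right_subset hx.2] with r hr
  exact hu.mono_set (hr.trans (Ioo_subset_Ioo_left hx.1.le))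

end ApproxLimits

/-! ### The jump energy of a function of bounded variation -/

section Energy

variable {a b : ℝ} {u : ℝ → ℝ} {j : JordanDecomposition ℝ} {c : ℝ}

lemma leftTrace_eq (hj : (j.posPart + j.negPart) (Ioo a b)ᶜ = 0)
    (hu : u =ᵐ[volume.restrict (Ioo a b)] bvRep j c) {x : ℝ} (hx : x ∈ Ioo a b) :
    leftTrace u x = bvRep j c x - (j.posPart.real {x} - j.negPart.real {x}) := by
  have h := isApproxLeftLim_of_tendsto hx hu (tendsto_bvRep_left j c x)
  have hex : ∃ l, IsApproxLeftLim u x l := ⟨_, h⟩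
  rw [leftTrace, dif_pos hex]
  exact hex.choose_spec.eq hx (memBV_of_ae_eq_bvRep hj hu).1 h

lemma rightTrace_eq (hj : (j.posPart + j.negPart) (Ioo a b)ᶜ = 0)
    (hu : u =ᵐ[volume.restrict (Ioo a b)] bvRep j c) {x : ℝ} (hx : x ∈ Ioo a b) :
    rightTrace u x = bvRep j c x := by
  have h := isApproxRightLim_of_tendsto hx hu (tendsto_bvRep_right j c x)
  have hex : ∃ l, IsApproxRightLim u x l := ⟨_, h⟩
  rw [rightTrace, dif_pos hex]
  exact hex.choose_spec.eq hx (memBV_of_ae_eq_bvRep hj hu).1 h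

/-- By mutual singularity a point is charged by at most one of the two parts. -/
lemma abs_posPart_sub_negPart_singleton (j : JordanDecomposition ℝ) (x : ℝ) :
    |j.posPart.real {x} - j.negPart.real {x}| = (j.posPart + j.negPart).real {x} := by
  obtain ⟨S, -, h1, h2⟩ := j.mutuallySingular
  rw [measureReal_add_apply]
  by_cases hx : x ∈ S
  · have : j.posPart.real {x} = 0 := by
      rw [measureReal_def, measure_mono_null (singleton_subset_iff.2 hx) h1, ENNReal.toReal_zero]
    rw [this, zero_sub, abs_neg, abs_of_nonneg measureReal_nonneg, zero_add]
  · have : j.negPart.real {x} = 0 := by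
      rw [measureReal_def, measure_mono_null (singleton_subset_iff.2 hx) h2, ENNReal.toReal_zero]
    rw [this, sub_zero, abs_of_nonneg measureReal_nonneg, add_zero]

/-- The one-sided limits of `bvRep` at `x` differ by the signed mass of `{x}`, and approximate
limits are unique. -/
lemma jumpSet_eq (hj : (j.posPart + j.negPart) (Ioo a b)ᶜ = 0)
    (hu : u =ᵐ[volume.restrict (Ioo a b)] bvRep j c) :
    jumpSet a b u = {x | (j.posPart + j.negPart) {x} ≠ 0} := by
  have hint := (memBV_of_ae_eq_bvRep hj hu).1
  have key : ∀ x, (j.posPart + j.negPart) {x} = 0 ↔ j.posPart.real {x} - j.negPart.real {x} = 0 := by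
    intro x
    rw [← abs_eq_zero, abs_posPart_sub_negPart_singleton,
      measureReal_eq_zero_iff (measure_ne_top _ _)]
  ext x
  rw [mem_ofPred_eq, Ne, key]
  constructor
  · rintro ⟨hx, l, r, hlr, hl, hr⟩ h0
    have h1 := hl.eq hx hint (isApproxLeftLim_of_tendsto hx hu (tendsto_bvRep_left j c x))
    have h2 := hr.eq hx hint (isApproxRightLim_of_tendsto hx hu (tendsto_bvRep_right j c x))
    rw [h0, sub_zero] at h1
    exact hlr (h1.trans h2.symm)
  · intro h0
    have hx : x ∈ Ioo a b := by
      by_contra hx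
      exact h0 ((key x).1 (measure_mono_null (singleton_subset_iff.2 hx) hj))
    refine ⟨hx, _, _, ?_, isApproxLeftLim_of_tendsto hx hu (tendsto_bvRep_left j c x),
      isApproxRightLim_of_tendsto hx hu (tendsto_bvRep_right j c x)⟩
    intro h
    exact h0 (by linarith)

/-- From here on, comparing energies of functions means comparing total variation measures. -/
lemma TVK_eq {K : ℝ → ℝ} (hK : CondK1 K) (hab : a < b)
    (hj : (j.posPart + j.negPart) (Ioo a b)ᶜ = 0)
    (hu : u =ᵐ[volume.restrict (Ioo a b)] bvRep j c) :
    TVK K a b u = jumpEnergy K (j.posPart + j.negPart) univ := by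
  rw [TVK, distribDeriv_eq hab hj hu, totalVariation_toSignedMeasure,
    jumpEnergy_apply MeasurableSet.univ, univ_inter, indicator_univ]
  congr 1
  · rw [jumpSet_eq hj hu]
    refine le_antisymm (measure_mono fun x hx => not_not.1 hx.2) ?_
    have hsub : {x | (j.posPart + j.negPart) {x} = 0} ⊆
        (Ioo a b \ {x | (j.posPart + j.negPart) {x} ≠ 0}) ∪ (Ioo a b)ᶜ := by
      intro x hx
      by_cases h : x ∈ Ioo a b
      · exact Or.inl ⟨h, not_not.2 hx⟩
      · exact Or.inr h
    refine (measure_mono hsub).trans ((measure_union_le _ _).trans ?_)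
    rw [hj, add_zero]
  · have e : ∀ x : jumpSet a b u, ENNReal.ofReal (K |rightTrace u x - leftTrace u x|) =
        ENNReal.ofReal (K ((j.posPart + j.negPart).real {(x : ℝ)})) := by
      intro x
      rw [leftTrace_eq hj hu x.2.1, rightTrace_eq hj hu x.2.1, sub_sub_cancel,
        abs_posPart_sub_negPart_singleton]
    simp_rw [e]
    refine tsum_subtype_eq_of_support_subset
      (f := fun x => ENNReal.ofReal (K ((j.posPart + j.negPart).real {x}))) fun x hx => ?_
    rw [jumpSet_eq hj hu]
    intro h0
    refine hx ?_
    simp only [measureReal_def, h0, ENNReal.toReal_zero, hK.2.2, ENNReal.ofReal_zero]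

lemma fidelity_congr {lam : ℝ} {g v w : ℝ → ℝ} (h : v =ᵐ[volume.restrict (Ioo a b)] w) :
    fidelity lam g a b v = fidelity lam g a b w := by
  rw [fidelity, fidelity]
  congr 1
  refine lintegral_congr_ae ?_
  filter_upwards [h] with x hx
  rw [hx]

end Energy

/-! ### A monotone competitor -/

section MonotoneCompetitor

/-- If `F` has increments bounded by those of `P`, then there is a nondecreasing function which has
the same property and is at least as close as `F` to the nondecreasing function `G`. -/
lemma exists_monotone_competitor {F G P : ℝ → ℝ} (hG : Monotone G) (hGc : Continuous G)
    (hP : Monotone P) (hF : ∀ x y, x ≤ y → F y - F x ≤ P y - P x) :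
    ∃ v : ℝ → ℝ, Monotone v ∧ (∀ x y, x ≤ y → v y - v x ≤ P y - P x) ∧
      ∀ x, |v x - G x| ≤ |F x - G x| := by
  have hbA : ∀ x, BddAbove ((fun y => min (F y) (G y)) '' Iic x) := by
    rintro x
    refine ⟨G x, ?_⟩
    rintro _ ⟨y, hy, rfl⟩
    exact (min_le_right _ _).trans (hG hy)
  have hbB : ∀ x, BddBelow ((fun y => max (F y) (G y)) '' Ici x) := by
    rintro x
    refine ⟨G x, ?_⟩
    rintro _ ⟨y, hy, rfl⟩
    exact (hG hy).trans (le_max_right _ _)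
  -- `A` is the least nondecreasing majorant of `min F G`, and `B` below is the greatest
  -- nondecreasing minorant of `max F G`, so `A ≤ G ≤ B`. At each point at least one of them equals
  -- `G`, so the competitor `A + B - G` is the other one, and it lies between `G` and `F`.
  obtain ⟨A, hA1, hA2⟩ : ∃ A : ℝ → ℝ, (∀ x, ∀ y ≤ x, min (F y) (G y) ≤ A x) ∧
      ∀ x c, (∀ y ≤ x, min (F y) (G y) ≤ c) → A x ≤ c := by
    refine ⟨fun x => sSup ((fun y => min (F y) (G y)) '' Iic x),
      fun x y hy => le_csSup (hbA x) ⟨y, hy, rfl⟩, fun x c h => csSup_le ⟨_, x, mem_Iic.2 le_rfl, rfl⟩ ?_⟩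
    rintro _ ⟨y, hy, rfl⟩
    exact h y hy
  obtain ⟨B, hB1, hB2⟩ : ∃ B : ℝ → ℝ, (∀ x, ∀ y, x ≤ y → B x ≤ max (F y) (G y)) ∧
      ∀ x c, (∀ y, x ≤ y → c ≤ max (F y) (G y)) → c ≤ B x := by
    refine ⟨fun x => sInf ((fun y => max (F y) (G y)) '' Ici x),
      fun x y hy => csInf_le (hbB x) ⟨y, hy, rfl⟩, fun x c h => le_csInf ⟨_, x, mem_Ici.2 le_rfl, rfl⟩ ?_⟩
    rintro _ ⟨y, hy, rfl⟩
    exact h y hy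
  have hAG : ∀ x, A x ≤ G x := fun x => hA2 x _ fun y hy => (min_le_right _ _).trans (hG hy)
  have hGB : ∀ x, G x ≤ B x := fun x => hB2 x _ fun y hy => (hG hy).trans (le_max_right _ _)
  have hAm : Monotone A := fun x y h => hA2 x _ fun z hz => hA1 y z (hz.trans h)
  have hBm : Monotone B := fun x y h => hB2 y _ fun z hz => hB1 x z (h.trans hz)
  have hAF : ∀ x, A x < G x → F x ≤ A x := fun x hx => by
    rcases min_le_iff.1 (hA1 x x le_rfl) with h | h
    · exact h
    · exact absurd hx (not_lt.2 h)
  have hBF : ∀ x, G x < B x → B x ≤ F x := fun x hx => by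
    rcases le_max_iff.1 (hB1 x x le_rfl) with h | h
    · exact h
    · exact absurd hx (not_lt.2 h)
  have hor : ∀ x, A x = G x ∨ B x = G x := by
    intro x
    rcases (hAG x).eq_or_lt with h | h
    · exact Or.inl h
    · refine Or.inr (le_antisymm ?_ (hGB x))
      by_contra! h'
      have h1 := hAF x h
      have h2 := hBF x h'
      linarith
  -- increments of `A`
  have hAinc : ∀ x y, x ≤ y → B x = G x → A y - A x ≤ P y - P x := by
    intro x y hxy hBx
    refine le_of_forall_pos_le_add fun ε hε => ?_
    rw [sub_le_iff_le_add]
    refine hA2 y _ fun s hs => ?_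
    have hPxy := hP hxy
    rcases le_or_gt s x with hsx | hxs
    · linarith [hA1 x s hsx]
    · have hPs := hP hs
      -- If `A x < G x`, then `F x ≤ A x` and the increment of `F` from `x` suffices. Otherwise `B x
      -- = G x` provides `w ≥ x` with `F w` and `G w` below `G x + ε`: before `w` the value of `G`
      -- is the bound, after `w` the increment of `F` from `w`.
      rcases (hAG x).eq_or_lt with h | h
      · obtain ⟨w, hxw, hw⟩ : ∃ w, x ≤ w ∧ max (F w) (G w) < G x + ε := by
          by_contra! hno
          linarith [hB2 x _ hno]
        rcases le_or_gt s w with hsw | hws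
        · have := (min_le_right (F s) (G s)).trans (hG hsw)
          linarith [(le_max_right _ _).trans_lt hw]
        · have h1 := hF w s hws.le
          have h2 := hP hxw
          linarith [(le_max_left _ _).trans_lt hw, min_le_left (F s) (G s)]
      · linarith [hAF x h, hF x s hxs.le, min_le_left (F s) (G s)]
  have hBinc : ∀ x y, x ≤ y → A y = G y → B y - B x ≤ P y - P x := by
    intro x y hxy hAy
    refine le_of_forall_pos_le_add fun ε hε => ?_
    have : B y - (P y - P x + ε) ≤ B x := by
      refine hB2 x _ fun s hs => ?_
      have hPxy := hP hxy
      rcases le_or_gt y s with hys | hsy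
      · linarith [hB1 y s hys]
      · have hPs := hP hs
        rcases (hGB y).eq_or_lt with h | h
        · obtain ⟨w, hwy, hw⟩ : ∃ w, w ≤ y ∧ G y - ε < min (F w) (G w) := by
            by_contra! hno
            linarith [hA2 y _ hno]
          rcases le_or_gt w s with hws | hsw
          · have := (hG hws).trans (le_max_right (F s) (G s))
            linarith [hw.trans_le (min_le_right _ _)]
          · have h1 := hF s w hsw.le
            have h2 := hP hwy
            linarith [hw.trans_le (min_le_left _ _), le_max_left (F s) (G s)]
        · linarith [hBF y h, hF s y hsy.le, le_max_left (F s) (G s)]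
    linarith
  -- a downward crossing
  have hcross : ∀ x y, x ≤ y → G x ≤ F x → F y ≤ G y → ∃ z, x ≤ z ∧ z ≤ y ∧
      A z = G z ∧ B z = G z := by
    intro x y hxy hx hy
    -- At `z = sup T`, points of `T` accumulate from the left or at `z` itself, and there `min F G =
    -- G`; just to the right of `z` one has `max F G = G`. Continuity of `G` carries both to `z`.
    set T := {s | s ∈ Icc x y ∧ G s ≤ F s} with hT
    have hxT : x ∈ T := ⟨⟨le_rfl, hxy⟩, hx⟩
    have hTb : BddAbove T := ⟨y, fun s hs => hs.1.2⟩
    set z := sSup T with hz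
    have hxz : x ≤ z := le_csSup hTb hxT
    have hzy : z ≤ y := csSup_le ⟨x, hxT⟩ fun s hs => hs.1.2
    refine ⟨z, hxz, hzy, le_antisymm (hAG z) (le_of_forall_pos_le_add fun ε hε => ?_),
      le_antisymm (le_of_forall_pos_le_add fun ε hε => ?_) (hGB z)⟩
    · obtain ⟨δ, hδ, hGδ⟩ := Metric.continuous_iff.1 hGc z ε hε
      obtain ⟨s, hsT, hs⟩ := exists_lt_of_lt_csSup ⟨x, hxT⟩ (sub_lt_self z hδ)
      have hsz : s ≤ z := le_csSup hTb hsT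
      have h1 := hGδ s (by rw [Real.dist_eq, abs_lt]; constructor <;> linarith)
      rw [Real.dist_eq, abs_lt] at h1
      have h2 := hA1 z s hsz
      rw [min_eq_right hsT.2] at h2
      linarith
    · rcases hzy.eq_or_lt with h | h
      · have h1 := hB1 z y h.le
        rw [max_eq_right hy, ← h] at h1
        linarith
      · obtain ⟨δ, hδ, hGδ⟩ := Metric.continuous_iff.1 hGc z ε hε
        obtain ⟨w, hzw, hw⟩ := exists_between (lt_min (lt_add_of_pos_right z hδ) h)
        have hwT : F w < G w := by
          by_contra! hn
          exact absurd (le_csSup hTb (show w ∈ T from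
            ⟨⟨hxz.trans hzw.le, (hw.trans_le (min_le_right _ _)).le⟩, hn⟩)) (not_le.2 hzw)
        have hwδ := hw.trans_le (min_le_left _ _)
        have h1 := hGδ w (by rw [Real.dist_eq, abs_lt]; constructor <;> linarith)
        rw [Real.dist_eq, abs_lt] at h1
        have h2 := hB1 z w hzw.le
        rw [max_eq_right hwT.le] at h2
        linarith
  have key : ∀ x y, x ≤ y → A x + B x - G x ≤ A y + B y - G y ∧
      A y + B y - G y - (A x + B x - G x) ≤ P y - P x := by
    intro x y hxy
    have hA := hAm hxy
    have hB := hBm hxy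
    by_cases hBx : B x = G x
    · by_cases hBy : B y = G y
      · have := hAinc x y hxy hBx
        constructor <;> linarith
      · have hAy := (hor y).resolve_right hBy
        by_cases hAx : A x = G x
        · have := hBinc x y hxy hAy
          constructor <;> linarith
        -- The competitor passes from below `G` to above it: `F` starts no higher and ends no lower,
        -- so its increment dominates.
        · have h1 := hAF x (lt_of_le_of_ne (hAG x) hAx)
          have h2 := hBF y (lt_of_le_of_ne (hGB y) (Ne.symm hBy))
          have h3 := hF x y hxy
          have h4 := hAG x
          constructor <;> linarith
    · have hAx := (hor x).resolve_right hBx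
      by_cases hAy : A y = G y
      · have := hBinc x y hxy hAy
        constructor <;> linarith
      · have hBy := (hor y).resolve_left hAy
        have h1 := hAF y (lt_of_le_of_ne (hAG y) hAy)
        have h2 := hBF x (lt_of_le_of_ne (hGB x) (Ne.symm hBx))
        -- The competitor passes from above `G` to below it, hence meets `G` at some `z`; the
        -- increment is split there, using `B` up to `z` and `A` after it.
        obtain ⟨z, hxz, hzy, hAz, hBz⟩ := hcross x y hxy ((hGB x).trans h2) (h1.trans (hAG y))
        have h3 := hBinc x z hxz hAz
        have h4 := hAinc z y hzy hBz
        have h5 := hBm hxz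
        have h6 := hAm hzy
        constructor <;> linarith
  refine ⟨fun x => A x + B x - G x, fun x y h => (key x y h).1, fun x y h => (key x y h).2,
    fun x => ?_⟩
  rcases hor x with h | h
  · have h0 := hGB x
    have e : A x + B x - G x - G x = B x - G x := by linarith
    rw [e, abs_of_nonneg (by linarith)]
    rcases h0.eq_or_lt with h1 | h1
    · rw [← h1, sub_self]; positivity
    · exact le_trans (by linarith [hBF x h1]) (le_abs_self _)
  · have h0 := hAG x
    have e : A x + B x - G x - G x = A x - G x := by linarith
    rw [e, abs_of_nonpos (by linarith)]
    rcases h0.eq_or_lt with h1 | h1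
    · rw [h1, sub_self, neg_zero]; positivity
    · exact le_trans (by linarith [hAF x h1]) (neg_le_abs _)

/-- A nondecreasing function with increments bounded by the finite measure `p` is the distribution
function of a smaller measure, up to a constant. -/
lemma exists_measure_of_increments_le {p : Measure ℝ} [IsFiniteMeasure p] {a b : ℝ}
    (hp : p (Ioo a b)ᶜ = 0) {v : ℝ → ℝ} (hv : Monotone v)
    (hvp : ∀ x y, x ≤ y → v y - v x ≤ p.real (Ioc x y)) :
    ∃ ν : Measure ℝ, ν ≤ p ∧ ∀ x, v x = v a + ν.real (Iic x) := by
  have hvP : ∀ x y, x ≤ y → v y - v x ≤ p.real (Iic y) - p.real (Iic x) := fun x y h => by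
    rw [measureReal_Iic_sub h]
    exact hvp x y h
  have hright : ∀ x, ContinuousWithinAt v (Ici x) x := by
    intro x
    rw [← continuousWithinAt_Ioi_iff_Ici]
    have h1 := (tendsto_measureReal_Iic_right (p := p) x).add_const (v x - p.real (Iic x))
    rw [add_sub_cancel] at h1
    refine tendsto_of_tendsto_of_tendsto_of_le_of_le' tendsto_const_nhds h1 ?_ ?_
    · filter_upwards [self_mem_nhdsWithin] with y hy using hv (mem_Ioi.1 hy).le
    · filter_upwards [self_mem_nhdsWithin] with y hy
      linarith [hvP x y (mem_Ioi.1 hy).le]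
  let f : StieltjesFunction ℝ := ⟨v, hv, hright⟩
  -- The increment bound says exactly that the difference is again nondecreasing. The two Stieltjes
  -- measures add up to `p`, so that of `v` is at most `p`.
  let h : StieltjesFunction ℝ := ⟨fun x => p.real (Iic x) - v x,
    fun x y hxy => by linarith [hvP x y hxy], fun x => by
      refine ContinuousWithinAt.sub ?_ (hright x)
      rw [← continuousWithinAt_Ioi_iff_Ici]
      exact tendsto_measureReal_Iic_right x⟩
  have hsum : f.measure + h.measure = p := by
    refine (Measure.ext_of_Ioc p _ fun x y hxy => ?_).symm
    rw [Measure.add_apply, StieltjesFunction.measure_Ioc, StieltjesFunction.measure_Ioc,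
      ← ENNReal.ofReal_add (sub_nonneg.2 (f.mono hxy.le)) (sub_nonneg.2 (h.mono hxy.le))]
    have e : f y - f x + (h y - h x) = p.real (Ioc x y) := by
      rw [← measureReal_Iic_sub hxy.le]
      change v y - v x + (p.real (Iic y) - v y - (p.real (Iic x) - v x)) = _
      ring
    rw [e, ofReal_measureReal]
  have hle : f.measure ≤ p := hsum ▸ Measure.le_add_right le_rfl
  have hfin : IsFiniteMeasure f.measure := isFiniteMeasure_of_le p hle
  refine ⟨f.measure, hle, fun x => ?_⟩
  have hnull : ∀ y ≤ a, f.measure (Iic y) = 0 := fun y hy =>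
    le_antisymm ((hle _).trans (le_of_eq (measure_mono_null (t := (Ioo a b)ᶜ)
      (fun z hz hz' => absurd (hz'.1.trans_le ((mem_Iic.1 hz).trans hy)) (lt_irrefl _)) hp)))
      bot_le
  rcases le_total a x with hx | hx
  · have h1 := measureReal_Iic_sub (p := f.measure) hx
    rw [measureReal_def f.measure (Iic a), hnull a le_rfl, ENNReal.toReal_zero, sub_zero] at h1
    rw [h1, measureReal_def, StieltjesFunction.measure_Ioc,
      ENNReal.toReal_ofReal (sub_nonneg.2 (f.mono hx))]
    change v x = v a + (v x - v a)
    ring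
  · rw [measureReal_def, hnull x hx, ENNReal.toReal_zero, add_zero]
    refine le_antisymm (hv hx) ?_
    have h1 := hvp x a hx
    have h2 : p.real (Ioc x a) = 0 := by
      rw [measureReal_def, measure_mono_null (t := (Ioo a b)ᶜ)
        (fun z hz hz' => absurd (hz'.1.trans_le hz.2) (lt_irrefl _)) hp, ENNReal.toReal_zero]
    linarith

end MonotoneCompetitor

/-! ### Minimizers -/

section Minimizer

variable {K g U : ℝ → ℝ} {a b lam : ℝ}

/-- A finite measure as a Jordan decomposition. -/
noncomputable def posJordan (ν : Measure ℝ) [IsFiniteMeasure ν] : JordanDecomposition ℝ :=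
  ⟨ν, 0, Measure.MutuallySingular.zero_right⟩

lemma bvRep_posJordan (ν : Measure ℝ) [IsFiniteMeasure ν] (c x : ℝ) :
    bvRep (posJordan ν) c x = c + ν.real (Iic x) := by
  simp [bvRep, posJordan]

lemma TVKg_eq (hK : CondK1 K) (hab : a < b) {ν : Measure ℝ} [IsFiniteMeasure ν]
    (hν : ν (Ioo a b)ᶜ = 0) {v : ℝ → ℝ} {c : ℝ}
    (hv : v =ᵐ[volume.restrict (Ioo a b)] fun x => c + ν.real (Iic x)) :
    TVKg K lam g a b v = jumpEnergy K ν univ +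
      fidelity lam g a b (fun x => c + ν.real (Iic x)) := by
  have hj : ((posJordan ν).posPart + (posJordan ν).negPart) (Ioo a b)ᶜ = 0 := by
    simpa [posJordan] using hν
  have hv' : v =ᵐ[volume.restrict (Ioo a b)] bvRep (posJordan ν) c := by
    filter_upwards [hv] with x hx
    rw [hx, bvRep_posJordan]
  rw [TVKg, TVK_eq hK hab hj hv', fidelity_congr hv]
  simp [posJordan]

lemma IsMinimizer.le (hU : IsMinimizer K lam g a b U) (hK : CondK1 K) (hab : a < b)
    {ν : Measure ℝ} [IsFiniteMeasure ν] (hν : ν (Ioo a b)ᶜ = 0) (c : ℝ) :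
    TVKg K lam g a b U ≤
      jumpEnergy K ν univ + fidelity lam g a b (fun x => c + ν.real (Iic x)) := by
  rw [← TVKg_eq hK hab hν (EventuallyEq.refl _ _)]
  refine hU.2 _ (memBV_of_ae_eq_bvRep (j := posJordan ν) (c := c) (by simpa [posJordan] using hν) ?_)
  exact Eventually.of_forall fun x => (bvRep_posJordan ν c x).symm

lemma fidelity_mono {v w : ℝ → ℝ} (h : ∀ x ∈ Ioo a b, |v x - g x| ≤ |w x - g x|) :
    fidelity lam g a b v ≤ fidelity lam g a b w := by
  refine mul_le_mul_right (setLIntegral_mono' measurableSet_Ioo fun x hx => ?_) _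
  exact ENNReal.ofReal_le_ofReal (pow_le_pow_left₀ (abs_nonneg _) (h x hx) 2)

lemma fidelity_ne_top {v : ℝ → ℝ} {D : ℝ} (h : ∀ x ∈ Ioo a b, |v x - g x| ≤ D) :
    fidelity lam g a b v ≠ ⊤ := by
  refine ENNReal.mul_ne_top ENNReal.ofReal_ne_top (ne_top_of_le_ne_top ?_
    (setLIntegral_mono' (g := fun _ => ENNReal.ofReal (D ^ 2)) measurableSet_Ioo fun x hx => ?_))
  · rw [setLIntegral_const]
    exact ENNReal.mul_ne_top ENNReal.ofReal_ne_top (by simp)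
  · exact ENNReal.ofReal_le_ofReal (pow_le_pow_left₀ (abs_nonneg _) (h x hx) 2)

/-- The zero function is a competitor of finite energy. Finiteness is what later permits cancelling
common terms in `ℝ≥0∞`. -/
lemma IsMinimizer.energy_ne_top (hU : IsMinimizer K lam g a b U) (hK : CondK1 K) (hab : a < b)
    (hg : ContinuousOn g (Icc a b)) : TVKg K lam g a b U ≠ ⊤ := by
  obtain ⟨D, hD⟩ := isCompact_Icc.exists_bound_of_continuousOn hg
  refine ne_top_of_le_ne_top ?_ (hU.le hK hab (ν := 0) (by simp) 0)
  refine ENNReal.add_ne_top.2 ⟨?_, fidelity_ne_top (D := D) fun x hx => ?_⟩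
  · rw [jumpEnergy_apply MeasurableSet.univ]
    simp [hK.2.2]
  · simpa using hD x (Ioo_subset_Icc_self hx)

/-- A minimizer for nondecreasing data has a nondecreasing representative. -/
lemma IsMinimizer.exists_measure (hU : IsMinimizer K lam g a b U) (hK : CondK1 K) (hab : a < b)
    (hg : ContinuousOn g (Icc a b)) (hgm : MonotoneOn g (Icc a b)) :
    ∃ (p : Measure ℝ) (c : ℝ), IsFiniteMeasure p ∧ p (Ioo a b)ᶜ = 0 ∧
      U =ᵐ[volume.restrict (Ioo a b)] fun x => c + p.real (Iic x) := by
  obtain ⟨j, c, hj, hUj⟩ := hU.1.exists_bvRep hab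
  have hfin := hU.energy_ne_top hK hab hg
  have hE : TVKg K lam g a b U =
      jumpEnergy K (j.posPart + j.negPart) univ + fidelity lam g a b (bvRep j c) := by
    rw [TVKg, TVK_eq hK hab hj hUj, fidelity_congr hUj]
  have hpos : j.posPart (Ioo a b)ᶜ = 0 := (add_eq_zero.1 hj).1
  obtain ⟨v, hvm, hvi, hvG⟩ := exists_monotone_competitor (F := bvRep j c)
    (G := IccExtend hab.le ((Icc a b).domRestrict g)) (P := fun x => j.posPart.real (Iic x))
    (Monotone.IccExtend hab.le fun x y hxy => hgm x.2 y.2 hxy)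
    (hg.domRestrict.Icc_extend' (h := hab.le)) monotone_measureReal_Iic (fun x y hxy => by
      rw [bvRep_sub_of_le j c hxy, measureReal_Iic_sub hxy]
      linarith [measureReal_nonneg (μ := j.negPart) (s := Ioc x y)])
  obtain ⟨ν, hνp, hν⟩ := exists_measure_of_increments_le hpos hvm fun x y hxy => by
    rw [← measureReal_Iic_sub hxy]
    exact hvi x y hxy
  have hνfin : IsFiniteMeasure ν := isFiniteMeasure_of_le _ hνp
  have hν0 : ν (Ioo a b)ᶜ = 0 := le_antisymm ((hνp _).trans hpos.le) bot_le
  have h1 := hU.le hK hab hν0 (v a)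
  have h2 : fidelity lam g a b (fun x => v a + ν.real (Iic x)) ≤
      fidelity lam g a b (bvRep j c) := fidelity_mono fun x hx => by
    have := hvG x
    rwa [IccExtend_of_mem hab.le _ (Ioo_subset_Icc_self hx), domRestrict_apply, hν x] at this
  rw [hE] at h1 hfin
  obtain ⟨hfin1, hfin2⟩ := ENNReal.add_ne_top.1 hfin
  have h3 : jumpEnergy K (j.posPart + j.negPart) univ ≤ jumpEnergy K ν univ :=
    (ENNReal.add_le_add_iff_right hfin2).1 (h1.trans (by gcongr))
  have h4 : ν = j.posPart + j.negPart :=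
    eq_of_jumpEnergy_univ_le hK (hνp.trans (Measure.le_add_right le_rfl)) h3 hfin1
  -- The competitor's measure is at most `j.posPart`, yet minimality made it equal to the whole
  -- total variation, leaving no room for `j.negPart`.
  have h5 : j.negPart univ = 0 := by
    have h6 := hνp univ
    rw [h4, Measure.add_apply] at h6
    by_contra hne
    exact absurd (h6.trans_lt (ENNReal.lt_add_right (measure_ne_top _ _) hne)) (lt_irrefl _)
  refine ⟨j.posPart, c, inferInstance, hpos, ?_⟩
  filter_upwards [hUj] with x hx
  rw [hx, bvRep, measureReal_def j.negPart, measure_mono_null (subset_univ _) h5]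
  simp

end Minimizer

/-! ### Bounds and merging of jumps -/

section Merging

variable {K g U : ℝ → ℝ} {a b lam : ℝ}

/-- The equality case of the pointwise comparison: ordered integrands with equal finite integrals
agree a.e. -/
lemma ae_eq_of_fidelity_le (hlam : 0 < lam) {v w : ℝ → ℝ}
    (hg : ContinuousOn g (Icc a b)) (hw : Measurable w)
    (h : ∀ x ∈ Ioo a b, |v x - g x| ≤ |w x - g x|) (hle : fidelity lam g a b w ≤ fidelity lam g a b v)
    (hfin : fidelity lam g a b v ≠ ⊤) :
    ∀ᵐ x ∂volume.restrict (Ioo a b), |v x - g x| = |w x - g x| := by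
  have hl0 : ENNReal.ofReal (lam / 2) ≠ 0 := by
    rw [Ne, ENNReal.ofReal_eq_zero]
    linarith
  have hgm : AEMeasurable g (volume.restrict (Ioo a b)) :=
    (hg.mono Ioo_subset_Icc_self).aemeasurable measurableSet_Ioo
  have h1 := ae_eq_of_ae_le_of_lintegral_le (μ := volume.restrict (Ioo a b))
    (f := fun x => ENNReal.ofReal (|v x - g x| ^ 2))
    (g := fun x => ENNReal.ofReal (|w x - g x| ^ 2))
    (by
      filter_upwards [ae_restrict_mem measurableSet_Ioo] with x hx
      exact ENNReal.ofReal_le_ofReal (pow_le_pow_left₀ (abs_nonneg _) (h x hx) 2))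
    (fun htop => hfin (by rw [fidelity, htop, ENNReal.mul_top hl0]))
    (((hw.aemeasurable.sub hgm).abs.pow_const 2).ennreal_ofReal)
    ((ENNReal.mul_le_mul_iff_right hl0 ENNReal.ofReal_ne_top).1 hle)
  filter_upwards [h1] with x hx
  rw [ENNReal.ofReal_eq_ofReal_iff (by positivity) (by positivity)] at hx
  exact (pow_left_inj₀ (abs_nonneg _) (abs_nonneg _) two_ne_zero).1 hx

/-- The representative of a minimizer takes its values between the extreme values of the data. -/
lemma IsMinimizer.bounds (hU : IsMinimizer K lam g a b U) (hK : CondK1 K) (hab : a < b)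
    (hlam : 0 < lam) (hg : ContinuousOn g (Icc a b)) (hgm : MonotoneOn g (Icc a b))
    {p : Measure ℝ} [IsFiniteMeasure p] {c : ℝ} (hp : p (Ioo a b)ᶜ = 0)
    (hUp : U =ᵐ[volume.restrict (Ioo a b)] fun x => c + p.real (Iic x)) :
    g a ≤ c ∧ c + p.real univ ≤ g b := by
  set F : ℝ → ℝ := fun x => c + p.real (Iic x) with hF
  -- Truncation shrinks increments, so it does not raise the jump energy, and it is strictly closer
  -- to `g` wherever it changes `F`. Minimality therefore gives `F = w` a.e.
  set w : ℝ → ℝ := fun x => max (g a) (min (g b) (F x)) with hw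
  have hFm : Monotone F := fun x y h => by
    have := monotone_measureReal_Iic (p := p) h
    simp only [hF] at this ⊢
    linarith
  have hwm : Monotone w := fun x y h => max_le_max le_rfl (min_le_min le_rfl (hFm h))
  have hwp : ∀ x y, x ≤ y → w y - w x ≤ p.real (Ioc x y) := by
    intro x y h
    have h1 : F y - F x = p.real (Ioc x y) := by
      rw [← measureReal_Iic_sub h]
      simp only [hF]
      ring
    have h2 := hFm h
    rw [← h1]
    simp only [hw]
    grind
  obtain ⟨ν, hνp, hν⟩ := exists_measure_of_increments_le hp hwm hwp
  have hνfin : IsFiniteMeasure ν := isFiniteMeasure_of_le _ hνp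
  have hν0 : ν (Ioo a b)ᶜ = 0 := le_antisymm ((hνp _).trans hp.le) bot_le
  have h1 := hU.le hK hab hν0 (w a)
  have hfin := hU.energy_ne_top hK hab hg
  rw [TVKg_eq hK hab hp hUp] at h1 hfin
  obtain ⟨hfin1, hfin2⟩ := ENNReal.add_ne_top.1 hfin
  have hgx : ∀ x ∈ Ioo a b, g a ≤ g x ∧ g x ≤ g b := fun x hx =>
    ⟨hgm ⟨le_rfl, hab.le⟩ (Ioo_subset_Icc_self hx) hx.1.le,
      hgm (Ioo_subset_Icc_self hx) ⟨hab.le, le_rfl⟩ hx.2.le⟩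
  have hwg : ∀ x ∈ Ioo a b, |w x - g x| ≤ |F x - g x| := by
    intro x hx
    have := hgx x hx
    simp only [hw]
    grind
  have hwν : (fun x => w a + ν.real (Iic x)) = w := funext fun x => (hν x).symm
  rw [hwν] at h1
  have h2 : fidelity lam g a b F ≤ fidelity lam g a b w :=
    (ENNReal.add_le_add_iff_left hfin1).1
      (h1.trans (add_le_add_left (jumpEnergy_univ_mono hK hνp) _))
  have h3 := ae_eq_of_fidelity_le hlam hg hFm.measurable hwg h2
    (ne_top_of_le_ne_top hfin2 (fidelity_mono hwg))
  have h4 : F =ᵐ[volume.restrict (Ioo a b)] w := by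
    filter_upwards [h3, ae_restrict_mem measurableSet_Ioo] with x hx hxm
    have := hgx x hxm
    simp only [hw] at hx ⊢
    grind
  have hFr : ∀ x, Tendsto F (𝓝[>] x) (𝓝 (F x)) := fun x =>
    (tendsto_measureReal_Iic_right x).const_add c
  have hFw : ∀ x ∈ Ico a b, F x = w x := fun x hx =>
    eq_of_ae_eq_of_tendsto_right h4 hx (hFr x)
      (tendsto_const_nhds.max (tendsto_const_nhds.min (hFr x)))
  have hgab : g a ≤ g b := hgm ⟨le_rfl, hab.le⟩ ⟨hab.le, le_rfl⟩ hab.le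
  constructor
  · have h5 : F a = c := by
      simp only [hF]
      rw [measureReal_def, measure_mono_null (t := (Ioo a b)ᶜ)
        (fun z hz hz' => absurd (hz'.1.trans_le (mem_Iic.1 hz)) (lt_irrefl _)) hp,
        ENNReal.toReal_zero, add_zero]
    rw [← h5, hFw a ⟨le_rfl, hab⟩]
    exact le_max_left _ _
  · have h5 : p.real univ = p.real (Iio b) := by
      rw [measureReal_def, measureReal_def]
      congr 1
      refine le_antisymm ?_ (measure_mono (subset_univ _))
      calc p univ ≤ p (Iio b ∪ (Ioo a b)ᶜ) := measure_mono fun y _ => by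
            by_cases hy : y < b
            · exact Or.inl hy
            · exact Or.inr fun h => hy h.2
        _ ≤ p (Iio b) + p (Ioo a b)ᶜ := measure_union_le _ _
        _ = p (Iio b) := by rw [hp, add_zero]
    rw [h5]
    refine le_of_tendsto ((tendsto_measureReal_Iic_left b).const_add c) ?_
    filter_upwards [Ioo_mem_nhdsLT hab] with y hy
    change F y ≤ g b
    rw [hFw y ⟨hy.1.le, hy.2⟩]
    exact max_le hgab (min_le_left _ _)

/-- A nondecreasing function crosses any level at some point of an interval, if at all. -/
lemma exists_crossing {x y : ℝ} (hxy : x ≤ y) (hgm : MonotoneOn g (Icc x y)) (m : ℝ) :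
    ∃ z ∈ Icc x y, (∀ w ∈ Icc x y, w < z → g w ≤ m) ∧ ∀ w ∈ Icc x y, z < w → m ≤ g w := by
  -- The point `x` is put in by hand so that `T` is nonempty even if `g` exceeds `m` throughout.
  set T := {w | w ∈ Icc x y ∧ (w = x ∨ g w ≤ m)} with hT
  have hxT : x ∈ T := ⟨⟨le_rfl, hxy⟩, Or.inl rfl⟩
  have hTb : BddAbove T := ⟨y, fun s hs => hs.1.2⟩
  refine ⟨sSup T, ⟨le_csSup hTb hxT, csSup_le ⟨x, hxT⟩ fun s hs => hs.1.2⟩, fun w hw hwz => ?_,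
    fun w hw hzw => ?_⟩
  · obtain ⟨t, ht, hwt⟩ := exists_lt_of_lt_csSup ⟨x, hxT⟩ hwz
    rcases ht.2 with h | h
    · exact absurd (h ▸ hwt) (not_lt.2 hw.1)
    · exact (hgm hw ht.1 hwt.le).trans h
  · by_contra! h
    exact absurd (le_csSup hTb (show w ∈ T from ⟨hw, Or.inr h.le⟩)) (not_le.2 hzw)

lemma mergeAt_real_Iic {p : Measure ℝ} [IsFiniteMeasure p] (S : Set ℝ) (z w : ℝ) :
    (mergeAt p S z).real (Iic w) = p.real (Iic w ∩ Sᶜ) + if z ≤ w then p.real S else 0 := by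
  rw [measureReal_def, mergeAt, Measure.add_apply, Measure.restrict_apply measurableSet_Iic,
    Measure.smul_apply, Measure.dirac_apply' _ measurableSet_Iic, smul_eq_mul,
    ENNReal.toReal_add (measure_ne_top _ _)]
  · by_cases h : z ≤ w <;> simp [h, measureReal_def]
  · by_cases h : z ≤ w <;> simp [h]

/-- The cost in fidelity of merging the variation in `[x,y]`. -/
lemma exists_merge_fidelity_le (hlam : 0 < lam) (hgm : MonotoneOn g (Icc a b))
    {p : Measure ℝ} [IsFiniteMeasure p] (c : ℝ) {x y : ℝ} (hax : a < x) (hxy : x ≤ y) (hyb : y < b)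
    {D : ℝ} (hD0 : 0 ≤ D) (hD : ∀ w ∈ Icc x y, p.real (Icc x w) * p.real (Ioc w y) ≤ D) :
    ∃ z ∈ Icc x y, fidelity lam g a b (fun w => c + (mergeAt p (Icc x y) z).real (Iic w)) ≤
      fidelity lam g a b (fun w => c + p.real (Iic w)) +
        ENNReal.ofReal (lam / 2 * (D * (y - x))) := by
  set S := Icc x y with hS
  have hSs : S ⊆ Icc a b := Icc_subset_Icc hax.le hyb.le
  set α := c + p.real (Iio x) with hα
  -- The level is the midpoint of the values `α` and `α + p S` taken on the two sides of the merged
  -- jump.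
  obtain ⟨z, hz, hz1, hz2⟩ := exists_crossing hxy (hgm.mono hSs) (α + p.real S / 2)
  refine ⟨z, hz, ?_⟩
  have hpt : ∀ w, w ≠ z → |c + (mergeAt p S z).real (Iic w) - g w| ^ 2 ≤
      |c + p.real (Iic w) - g w| ^ 2 + S.indicator (fun _ => D) w := by
    intro w hwz
    rw [sq_abs, sq_abs, mergeAt_real_Iic]
    by_cases hw : w ∈ S
    · have hDw := hD w hw
      set A := p.real (Icc x w)
      set B := p.real (Ioc w y)
      have hA : 0 ≤ A := measureReal_nonneg
      have hB : 0 ≤ B := measureReal_nonneg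
      have e1 : p.real S = A + B := by
        rw [hS, ← Icc_union_Ioc_eq_Icc hw.1 hw.2, measureReal_union
          (disjoint_left.2 fun t ht ht' => not_lt.2 ht.2 ht'.1) measurableSet_Ioc]
      have e2 : c + p.real (Iic w) = α + A := by
        rw [hα, ← Iio_union_Icc_eq_Iic hw.1, measureReal_union
          (disjoint_left.2 fun t ht ht' => not_lt.2 ht'.1 (mem_Iio.1 ht)) measurableSet_Icc, add_assoc]
      have e3 : Iic w ∩ Sᶜ = Iio x := by
        ext t
        simp only [mem_inter_iff, mem_Iic, mem_compl_iff, mem_Iio, hS, mem_Icc, not_and, not_le]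
        constructor
        · rintro ⟨h1, h2⟩
          by_contra! h3
          exact absurd (h2 h3) (not_lt.2 (h1.trans hw.2))
        · exact fun h => ⟨h.le.trans hw.1, fun h' => absurd h (not_lt.2 h')⟩
      rw [e3, e2, indicator_of_mem hw, ← add_assoc, ← hα]
      -- Left of `z` the value `α + A` drops to `α`, and the square changes by `A * (2 * (g w - α) -
      -- A) ≤ A * B`. Right of `z` it rises to `α + A + B`, and the change is `B * (2 * (α + A - g
      -- w) + B) ≤ A * B`.
      rcases lt_or_gt_of_ne hwz with h | h
      · rw [if_neg (not_le.2 h)]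
        have := hz1 w hw h
        rw [e1] at this
        nlinarith [mul_nonneg hA (sub_nonneg.2 this)]
      · rw [if_pos h.le, e1]
        have := hz2 w hw h
        rw [e1] at this
        nlinarith [mul_nonneg hB (sub_nonneg.2 this)]
    · rw [indicator_of_notMem hw, add_zero]
      refine le_of_eq ?_
      congr 3
      rcases lt_or_ge w x with h | h
      · rw [if_neg (not_le.2 (h.trans_le hz.1)), add_zero, inter_eq_self_of_subset_left]
        exact fun t ht ht' => absurd (ht'.1.trans (mem_Iic.1 ht)) (not_le.2 h)
      · have hyw : y < w := by
          by_contra! h'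
          exact hw ⟨h, h'⟩
        rw [if_pos (hz.2.trans hyw.le), ← measureReal_inter_add_sdiff (s := Iic w) measurableSet_Icc
          (t := S), inter_eq_self_of_subset_right (s := Iic w) (t := S)
          (fun t ht => ht.2.trans hyw.le), Set.sdiff_eq, add_comm]
  rw [fidelity, fidelity, ENNReal.ofReal_mul (by positivity), ← mul_add]
  refine mul_le_mul_right ?_ _
  have hne : ∀ᵐ w ∂(volume.restrict (Ioo a b)), w ≠ z :=
    ae_restrict_of_ae (compl_mem_ae_iff.2 (measure_singleton z))
  calc ∫⁻ w in Ioo a b, ENNReal.ofReal (|c + (mergeAt p S z).real (Iic w) - g w| ^ 2)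
      ≤ ∫⁻ w in Ioo a b, (ENNReal.ofReal (|c + p.real (Iic w) - g w| ^ 2) +
          S.indicator (fun _ => ENNReal.ofReal D) w) := by
        refine lintegral_mono_ae ?_
        filter_upwards [hne] with w hw
        refine (ENNReal.ofReal_le_ofReal (hpt w hw)).trans (ENNReal.ofReal_add_le.trans ?_)
        gcongr
        by_cases h : w ∈ S <;> simp [h]
    _ = (∫⁻ w in Ioo a b, ENNReal.ofReal (|c + p.real (Iic w) - g w| ^ 2)) +
          ∫⁻ w in Ioo a b, S.indicator (fun _ => ENNReal.ofReal D) w :=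
        lintegral_add_right _ (measurable_const.indicator measurableSet_Icc)
    _ ≤ _ := by
        gcongr
        refine (setLIntegral_le_lintegral _ _).trans ?_
        rw [lintegral_indicator measurableSet_Icc, setLIntegral_const, Real.volume_Icc,
          ENNReal.ofReal_mul hD0]

/-- The interaction inequality for minimizers. -/
lemma IsMinimizer.interaction_le (hU : IsMinimizer K lam g a b U) (hK1 : CondK1 K)
    (hK2 : CondK2 K) (hK3 : CondK3 K) (hab : a < b) (hlam : 0 < lam)
    (hg : ContinuousOn g (Icc a b)) (hgm : MonotoneOn g (Icc a b))
    {p : Measure ℝ} [IsFiniteMeasure p] {c : ℝ} (hp : p (Ioo a b)ᶜ = 0)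
    (hUp : U =ᵐ[volume.restrict (Ioo a b)] fun x => c + p.real (Iic x))
    {M C : ℝ} (hM : p.real univ ≤ M) (hC : IsK2Const K M C) {x y : ℝ} (hax : a < x) (hxy : x ≤ y)
    (hyb : y < b) {D : ℝ} (hD0 : 0 ≤ D)
    (hD : ∀ w ∈ Icc x y, p.real (Icc x w) * p.real (Ioc w y) ≤ D) {w : ℝ} (hw : w ∈ Icc x y) :
    C * (p.real (Icc x w) * p.real (Ioc w y)) ≤ lam / 2 * (D * (y - x)) := by
  obtain ⟨z, hz, hfid⟩ := exists_merge_fidelity_le hlam hgm c hax hxy hyb hD0 hD (p := p)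
  set S := Icc x y with hS
  have hSm : MeasurableSet S := measurableSet_Icc
  have hfin : IsFiniteMeasure (mergeAt p S z) := by
    constructor
    simp [mergeAt, measure_lt_top]
  have hm0 : mergeAt p S z (Ioo a b)ᶜ = 0 := by
    have hzab : z ∈ Ioo a b := ⟨hax.trans_le hz.1, hz.2.trans_lt hyb⟩
    rw [mergeAt, Measure.add_apply, Measure.restrict_apply measurableSet_Ioo.compl,
      Measure.smul_apply, Measure.dirac_apply' _ measurableSet_Ioo.compl,
      indicator_of_notMem (not_not.2 hzab), smul_zero, add_zero]
    exact measure_mono_null inter_subset_left hp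
  have h1 := hU.le hK1 hab hm0 c
  have htop := hU.energy_ne_top hK1 hab hg
  rw [TVKg_eq hK1 hab hp hUp, ← measure_add_measure_compl hSm] at h1 htop
  obtain ⟨hfin1, hfin2⟩ := ENNReal.add_ne_top.1 htop
  have hfin3 := (ENNReal.add_ne_top.1 hfin1).2
  set A := p.real (Icc x w)
  set B := p.real (Ioc w y)
  have hA : 0 ≤ A := measureReal_nonneg
  have hB : 0 ≤ B := measureReal_nonneg
  have hdisj : Disjoint (Icc x w) (Ioc w y) := disjoint_left.2 fun t ht ht' => not_lt.2 ht.2 ht'.1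
  have e1 : p.real S = A + B := by
    rw [hS, ← Icc_union_Ioc_eq_Icc hw.1 hw.2, measureReal_union hdisj measurableSet_Ioc]
  -- The gain: the pieces on both sides of `w` cost at least `K A` and `K B`, which exceed `K (A +
  -- B)` by (K2).
  have h2 : ENNReal.ofReal (K (p.real S)) + ENNReal.ofReal (C * (A * B)) ≤ jumpEnergy K p S := by
    have hAB : K (A + B) + C * (A * B) ≤ K A + K B := by
      have := hC.2 A B hA hB (by rw [← e1]; exact (measureReal_mono (subset_univ _)).trans hM)
      linarith [mul_assoc C A B]
    rw [e1, ← ENNReal.ofReal_add (hK1.nonneg (by positivity)) (by have := hC.1; positivity)]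
    refine (ENNReal.ofReal_le_ofReal hAB).trans ?_
    rw [ENNReal.ofReal_add (hK1.nonneg hA) (hK1.nonneg hB), hS, ← Icc_union_Ioc_eq_Icc hw.1 hw.2,
      measure_union hdisj measurableSet_Ioc]
    exact add_le_add (ofReal_jump_le_jumpEnergy hK1 hK2 hK3 measurableSet_Icc)
      (ofReal_jump_le_jumpEnergy hK1 hK2 hK3 measurableSet_Ioc)
  have h3 := jumpEnergy_mergeAt_le hK1 hSm hz (p := p)
  set R := jumpEnergy K p Sᶜ + ENNReal.ofReal (K (p.real S)) +
    fidelity lam g a b (fun w => c + p.real (Iic w)) with hR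
  have hRtop : R ≠ ⊤ := ENNReal.add_ne_top.2
    ⟨ENNReal.add_ne_top.2 ⟨hfin3, ENNReal.ofReal_ne_top⟩, hfin2⟩
  have h4 : R + ENNReal.ofReal (C * (A * B)) ≤ R + ENNReal.ofReal (lam / 2 * (D * (y - x))) := by
    calc R + ENNReal.ofReal (C * (A * B))
        = ENNReal.ofReal (K (p.real S)) + ENNReal.ofReal (C * (A * B)) + jumpEnergy K p Sᶜ +
          fidelity lam g a b (fun w => c + p.real (Iic w)) := by rw [hR]; ring
      _ ≤ jumpEnergy K p S + jumpEnergy K p Sᶜ +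
          fidelity lam g a b (fun w => c + p.real (Iic w)) := by gcongr
      _ ≤ _ := h1
      _ ≤ jumpEnergy K p Sᶜ + ENNReal.ofReal (K (p.real S)) +
          (fidelity lam g a b (fun w => c + p.real (Iic w)) +
            ENNReal.ofReal (lam / 2 * (D * (y - x)))) := add_le_add h3 hfid
      _ = _ := by rw [hR]; ring
  have h5 := (ENNReal.add_le_add_iff_left hRtop).1 h4
  exact (ENNReal.ofReal_le_ofReal_iff
    (mul_nonneg (by positivity) (mul_nonneg hD0 (sub_nonneg.2 hxy)))).1 h5

/-- On short intervals, the derivative of a minimizer does not interact with itself. -/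
lemma IsMinimizer.interaction_eq_zero (hU : IsMinimizer K lam g a b U) (hK1 : CondK1 K)
    (hK2 : CondK2 K) (hK3 : CondK3 K) (hab : a < b) (hlam : 0 < lam)
    (hg : ContinuousOn g (Icc a b)) (hgm : MonotoneOn g (Icc a b))
    {p : Measure ℝ} [IsFiniteMeasure p] {c : ℝ} (hp : p (Ioo a b)ᶜ = 0)
    (hUp : U =ᵐ[volume.restrict (Ioo a b)] fun x => c + p.real (Iic x))
    {M C : ℝ} (hM : p.real univ ≤ M) (hC : IsK2Const K M C) {x y : ℝ} (hax : a < x) (hxy : x ≤ y)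
    (hyb : y < b) (hshort : y - x < 2 * C / lam) {w : ℝ} (hw : w ∈ Icc x y) :
    p (Icc x w) = 0 ∨ p (Ioc w y) = 0 := by
  set f : ℝ → ℝ := fun w => p.real (Icc x w) * p.real (Ioc w y) with hf
  have hf0 : ∀ w, 0 ≤ f w := fun w => mul_nonneg measureReal_nonneg measureReal_nonneg
  have hbdd : BddAbove (f '' Icc x y) := by
    refine ⟨p.real univ * p.real univ, ?_⟩
    rintro _ ⟨w, -, rfl⟩
    exact mul_le_mul (measureReal_mono (subset_univ _)) (measureReal_mono (subset_univ _))
      measureReal_nonneg measureReal_nonneg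
  set D := sSup (f '' Icc x y) with hDdef
  have hD : ∀ w ∈ Icc x y, f w ≤ D := fun w hw => le_csSup hbdd ⟨w, hw, rfl⟩
  have hD0 : 0 ≤ D := (hf0 w).trans (hD w hw)
  have hCpos := hC.1
  have h1 : ∀ w ∈ Icc x y, f w ≤ lam / 2 * (D * (y - x)) / C := fun w hw => by
    rw [le_div_iff₀ hCpos, mul_comm]
    exact hU.interaction_le hK1 hK2 hK3 hab hlam hg hgm hp hUp hM hC hax hxy hyb hD0 hD hw
  have h2 : D ≤ lam / 2 * (D * (y - x)) / C := by
    refine csSup_le ⟨_, w, hw, rfl⟩ ?_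
    rintro _ ⟨v, hv, rfl⟩
    exact h1 v hv
  -- The supremum satisfies `D ≤ θ * D` with `θ = lam * (y - x) / (2 * C) < 1`.
  have hD' : D = 0 := by
    by_contra hne
    have hDpos : 0 < D := lt_of_le_of_ne hD0 (Ne.symm hne)
    rw [le_div_iff₀ hCpos] at h2
    rw [lt_div_iff₀ hlam] at hshort
    nlinarith
  have h3 : f w = 0 := le_antisymm ((hD w hw).trans hD'.le) (hf0 w)
  rcases mul_eq_zero.1 h3 with h | h
  · exact Or.inl ((measureReal_eq_zero_iff (measure_ne_top _ _)).1 h)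
  · exact Or.inr ((measureReal_eq_zero_iff (measure_ne_top _ _)).1 h)

end Merging

/-! ### Structure of measures without self-interaction on short intervals -/

section Atomic

variable {p : Measure ℝ}

/-- Take `z` to be the infimum of the `w` with no mass to their right. Before `z` the other
alternative must hold; one-sided continuity of the distribution function then removes the mass on
both sides of `z`. -/
lemma exists_measure_sdiff_singleton_eq_zero [IsFiniteMeasure p] {x y : ℝ} (hxy : x ≤ y)
    (h : ∀ w ∈ Icc x y, p (Icc x w) = 0 ∨ p (Ioc w y) = 0) :
    ∃ z ∈ Icc x y, p (Icc x y \ {z}) = 0 := by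
  set T := {w | w ∈ Icc x y ∧ p (Ioc w y) = 0} with hT
  have hyT : y ∈ T := ⟨⟨hxy, le_rfl⟩, by simp⟩
  have hTb : BddBelow T := ⟨x, fun s hs => hs.1.1⟩
  set z := sInf T with hz
  have hxz : x ≤ z := le_csInf ⟨y, hyT⟩ fun s hs => hs.1.1
  have hzy : z ≤ y := csInf_le hTb hyT
  refine ⟨z, ⟨hxz, hzy⟩, ?_⟩
  have hleft : p (Ico x z) = 0 := by
    rcases hxz.eq_or_lt with he | hlt
    · rw [← he, Ico_self, measure_empty]
    · have h1 : ∀ w ∈ Ioo x z, p.real (Iic w) = p.real (Iio x) := by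
        intro w hw
        have hwxy : w ∈ Icc x y := ⟨hw.1.le, (hw.2.trans_le hzy).le⟩
        have h2 : p (Icc x w) = 0 := (h w hwxy).resolve_right fun h3 =>
          absurd (csInf_le hTb (show w ∈ T from ⟨hwxy, h3⟩)) (not_le.2 hw.2)
        rw [← Iio_union_Icc_eq_Iic hw.1.le, measureReal_union
          (disjoint_left.2 fun t ht ht' => not_lt.2 ht'.1 (mem_Iio.1 ht)) measurableSet_Icc,
          measureReal_def p (Icc x w), h2, ENNReal.toReal_zero, add_zero]
      have h2 : p.real (Iio z) = p.real (Iio x) := by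
        refine tendsto_nhds_unique (tendsto_measureReal_Iic_left z)
          (tendsto_const_nhds.congr' ?_)
        filter_upwards [Ioo_mem_nhdsLT hlt] with w hw using (h1 w hw).symm
      rw [← Iio_union_Ico_eq_Iio hxz, measureReal_union
        (disjoint_left.2 fun t ht ht' => not_lt.2 ht'.1 (mem_Iio.1 ht)) measurableSet_Ico] at h2
      exact (measureReal_eq_zero_iff (measure_ne_top _ _)).1 (by linarith)
  have hright : p (Ioc z y) = 0 := by
    rcases hzy.eq_or_lt with he | hlt
    · rw [he, Ioc_self, measure_empty]
    · have h1 : ∀ w ∈ Ioo z y, p.real (Iic w) = p.real (Iic y) := by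
        intro w hw
        obtain ⟨t, ht, htw⟩ := exists_lt_of_csInf_lt ⟨y, hyT⟩ hw.1
        have h2 : p (Ioc w y) = 0 := measure_mono_null (Ioc_subset_Ioc_left htw.le) ht.2
        have h3 := measureReal_Iic_sub (p := p) hw.2.le
        rw [measureReal_def p (Ioc w y), h2, ENNReal.toReal_zero] at h3
        linarith
      have h2 : p.real (Iic z) = p.real (Iic y) := by
        refine tendsto_nhds_unique (tendsto_measureReal_Iic_right z)
          (tendsto_const_nhds.congr' ?_)
        filter_upwards [Ioo_mem_nhdsGT hlt] with w hw using (h1 w hw).symm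
      have h3 := measureReal_Iic_sub (p := p) hzy
      rw [h2, sub_self] at h3
      exact (measureReal_eq_zero_iff (measure_ne_top _ _)).1 h3.symm
  refine measure_mono_null (t := Ico x z ∪ Ioc z y) (fun t ht => ?_)
    (measure_union_null hleft hright)
  rcases lt_or_gt_of_ne ht.2 with h1 | h1
  · exact Or.inl ⟨ht.1.1, h1⟩
  · exact Or.inr ⟨h1, ht.1.2⟩

variable {a b δ : ℝ}

/-- Near every point the mass sits at a single `z`, which belongs to the set only if it is massless.
Locally null sets are null. -/
lemma measure_nonatoms_eq_zero (hδ : 0 < δ) (hp : p (Ioo a b)ᶜ = 0)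
    (h : ∀ x y, a < x → x ≤ y → y < b → y - x < δ → ∃ z ∈ Icc x y, p (Icc x y \ {z}) = 0) :
    p {x | p {x} = 0} = 0 := by
  have h1 : p (Ioo a b ∩ {x | p {x} = 0}) = 0 := by
    refine measure_null_of_locally_null _ fun x hx => ?_
    set ε := min (δ / 4) (min ((x - a) / 2) ((b - x) / 2)) with hε
    have hxa := sub_pos.2 hx.1.1
    have hxb := sub_pos.2 hx.1.2
    have hε0 : 0 < ε := lt_min (by positivity) (lt_min (by positivity) (by positivity))
    have hε1 : ε ≤ δ / 4 := min_le_left _ _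
    have hε2 : ε ≤ (x - a) / 2 := (min_le_right _ _).trans (min_le_left _ _)
    have hε3 : ε ≤ (b - x) / 2 := (min_le_right _ _).trans (min_le_right _ _)
    obtain ⟨z, -, hz⟩ := h (x - ε) (x + ε) (by linarith) (by linarith) (by linarith) (by linarith)
    refine ⟨Icc (x - ε) (x + ε) ∩ (Ioo a b ∩ {x | p {x} = 0}),
      inter_mem (mem_nhdsWithin_of_mem_nhds (Icc_mem_nhds (by linarith) (by linarith)))
        self_mem_nhdsWithin, ?_⟩
    refine measure_mono_null (t := (Icc (x - ε) (x + ε) \ {z}) ∪ ({z} ∩ {x | p {x} = 0}))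
      (fun t ht => ?_) (measure_union_null hz ?_)
    · by_cases htz : t = z
      · exact Or.inr ⟨htz, ht.2.2⟩
      · exact Or.inl ⟨ht.1, htz⟩
    · exact measure_eq_zero_of_countable ((countable_singleton z).mono inter_subset_left)
        fun t ht => ht.2
  refine measure_mono_null (t := (Ioo a b ∩ {x | p {x} = 0}) ∪ (Ioo a b)ᶜ) (fun x hx => ?_)
    (measure_union_null h1 hp)
  by_cases hxab : x ∈ Ioo a b
  · exact Or.inl ⟨hxab, hx⟩
  · exact Or.inr hxab

lemma le_sub_of_atoms (hp : p (Ioo a b)ᶜ = 0)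
    (h : ∀ x y, a < x → x ≤ y → y < b → y - x < δ → ∃ z ∈ Icc x y, p (Icc x y \ {z}) = 0)
    {x y : ℝ} (hx : p {x} ≠ 0) (hy : p {y} ≠ 0) (hxy : x < y) : δ ≤ y - x := by
  by_contra! hlt
  have hmem : ∀ t, p {t} ≠ 0 → t ∈ Ioo a b := fun t ht => by
    by_contra htn
    exact ht (measure_mono_null (singleton_subset_iff.2 htn) hp)
  obtain ⟨z, -, hz⟩ := h x y (hmem x hx).1 hxy.le (hmem y hy).2 hlt
  by_cases hxz : x = z
  · refine hy (measure_mono_null (singleton_subset_iff.2 ?_) hz)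
    exact ⟨⟨hxy.le, le_rfl⟩, fun hyz => hxy.ne (hxz.trans hyz.symm)⟩
  · exact hx (measure_mono_null (t := Icc x y \ {z}) (singleton_subset_iff.2 ⟨⟨le_rfl, hxy.le⟩, hxz⟩) hz)

end Atomic

/-! ### Separated sets and gluing of constant pieces -/

section Counting

variable {a b δ : ℝ}

/-- The map `x ↦ ⌊(x - a) / δ⌋₊` is injective on `J` and takes values in `{0, …, ⌊(b - a) / δ⌋₊}`.
-/
lemma encard_le_of_separated (hδ : 0 < δ) {J : Set ℝ} (hJ : J ⊆ Ioo a b)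
    (hsep : ∀ x ∈ J, ∀ y ∈ J, x < y → δ ≤ y - x) :
    J.encard ≤ ((⌊(b - a) / δ⌋₊ + 1 : ℕ) : ℕ∞) := by
  have hnn : ∀ x ∈ J, 0 ≤ (x - a) / δ := fun x hx =>
    div_nonneg (sub_nonneg.2 (hJ hx).1.le) hδ.le
  have hlt : ∀ x ∈ J, ∀ y ∈ J, x < y → ⌊(x - a) / δ⌋₊ < ⌊(y - a) / δ⌋₊ := by
    intro x hx y hy hxy
    rw [Nat.lt_iff_add_one_le, ← Nat.floor_add_one (hnn x hx)]
    refine Nat.floor_le_floor ?_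
    rw [div_add_one hδ.ne']
    have := hsep x hx y hy hxy
    gcongr
    linarith
  have hinj : InjOn (fun x => ⌊(x - a) / δ⌋₊) J := by
    intro x hx y hy hxy
    by_contra hne
    rcases lt_or_gt_of_ne hne with h | h
    · exact (hlt x hx y hy h).ne hxy
    · exact (hlt y hy x hx h).ne hxy.symm
  have hmaps : MapsTo (fun x => ⌊(x - a) / δ⌋₊) J (Finset.range (⌊(b - a) / δ⌋₊ + 1)) := by
    intro x hx
    simp only [Finset.coe_range, mem_Iio, Nat.lt_succ_iff]
    refine Nat.floor_le_floor ?_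
    have := (hJ hx).2.le
    gcongr
  refine (encard_le_encard_of_injOn hmaps hinj).trans ?_
  rw [encard_coe_eq_coe_finsetCard, Finset.card_range]

lemma IsPiecewiseConst.append {m : ℝ} {V : ℝ → ℝ} (h : IsPiecewiseConst a m V) (hmb : m < b)
    (hV : ∃ c, ∀ x ∈ Ioo m b, V x = c) : IsPiecewiseConst a b V := by
  obtain ⟨n, t, c, h0, hn, ht⟩ := h
  obtain ⟨d, hd⟩ := hV
  -- The old nodes end with `t (n + 1) = m`, so `b` becomes node `n + 2`, while the new constant has
  -- index `n + 1`.
  refine ⟨n + 1, fun i => if i ≤ n + 1 then t i else b, fun i => if i ≤ n then c i else d,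
    by simp [h0], by simp, fun i hi => ?_⟩
  rcases Nat.lt_or_ge n i with h | h
  · obtain rfl : i = n + 1 := by omega
    simp only [le_refl, if_true, hn]
    rw [if_neg (by omega), if_neg (by omega)]
    exact ⟨hmb, hd⟩
  · simp only
    rw [if_pos (by omega), if_pos (by omega), if_pos h]
    exact ht i h

/-- The induction removes the largest point `m` of `J` and continues on `(a,m)`, so `b` has to vary.
-/
lemma isPiecewiseConst_of_finset {V : ℝ → ℝ} (J : Finset ℝ) :
    ∀ b, a < b → (∀ x ∈ J, x ∈ Ioo a b) →
      (∀ s t, a ≤ s → s < t → t ≤ b → (∀ x ∈ J, x ∉ Ioo s t) → ∃ c, ∀ x ∈ Ioo s t, V x = c) →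
      IsPiecewiseConst a b V := by
  induction J using Finset.induction_on_max with
  | empty =>
    intro b hab _ h
    obtain ⟨c, hc⟩ := h a b le_rfl hab le_rfl (by simp)
    refine ⟨0, fun i => if i = 0 then a else b, fun _ => c, by simp, by simp, fun i hi => ?_⟩
    obtain rfl : i = 0 := by omega
    simpa using ⟨hab, fun x h1 h2 => hc x ⟨h1, h2⟩⟩
  | insert m s hs ih =>
    intro b hab hJ h
    have hm := hJ m (Finset.mem_insert_self m s)
    refine IsPiecewiseConst.append (m := m) (ih m hm.1 (fun x hx =>
      ⟨(hJ x (Finset.mem_insert_of_mem hx)).1, hs x hx⟩) fun r t har hrt htm hst => ?_) hm.2 ?_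
    · refine h r t har hrt (htm.trans hm.2.le) fun x hx => ?_
      rcases Finset.mem_insert.1 hx with rfl | hx
      · exact fun h => absurd h.2 (not_lt.2 htm)
      · exact hst x hx
    · refine h m b hm.1.le hm.2 le_rfl fun x hx => ?_
      rcases Finset.mem_insert.1 hx with rfl | hx
      · exact fun h => lt_irrefl _ h.1
      · exact fun h => lt_asymm h.1 (hs x hx)

end Counting

/-! ### The structure of minimizers -/

section Structure

variable {K g U : ℝ → ℝ} {a b lam : ℝ}

lemma jumpSet_eq_of_ae_eq {p : Measure ℝ} [IsFiniteMeasure p] {c : ℝ} (hp : p (Ioo a b)ᶜ = 0)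
    (hUp : U =ᵐ[volume.restrict (Ioo a b)] fun x => c + p.real (Iic x)) :
    jumpSet a b U = {x | p {x} ≠ 0} := by
  rw [jumpSet_eq (j := posJordan p) (c := c) (by simpa [posJordan] using hp)]
  · simp [posJordan]
  · filter_upwards [hUp] with x hx
    rw [hx, bvRep_posJordan]

lemma IsMinimizer.exists_rep (hU : IsMinimizer K lam g a b U) (hK1 : CondK1 K)
    (hK2 : CondK2 K) (hK3 : CondK3 K) (hab : a < b) (hlam : 0 < lam)
    (hg : ContinuousOn g (Icc a b)) (hgm : MonotoneOn g (Icc a b)) :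
    (∃ V : ℝ → ℝ, IsGoodRep a b U V ∧ MonotoneOn V (Icc a b) ∧ IsPiecewiseConst a b V ∧
      ∀ x ∈ Icc a b, g a ≤ V x ∧ V x ≤ g b) ∧
    ∀ M C : ℝ, |g b - g a| ≤ M → IsK2Const K M C →
      (jumpSet a b U).encard ≤ ((⌊(b - a) * lam / (2 * C)⌋₊ + 1 : ℕ) : ℕ∞) := by
  obtain ⟨p, c, hfin, hp, hUp⟩ := hU.exists_measure hK1 hab hg hgm
  obtain ⟨hlow, hupp⟩ := hU.bounds hK1 hab hlam hg hgm hp hUp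
  have hJ := jumpSet_eq_of_ae_eq hp hUp
  have hJab : {x | p {x} ≠ 0} ⊆ Ioo a b := hJ ▸ fun x hx => hx.1
  have hshort : ∀ M C : ℝ, |g b - g a| ≤ M → IsK2Const K M C → ∀ x y, a < x → x ≤ y → y < b →
      y - x < 2 * C / lam → ∃ z ∈ Icc x y, p (Icc x y \ {z}) = 0 := by
    intro M C hM hC x y hax hxy hyb hlt
    have hpM : p.real univ ≤ M := by linarith [le_abs_self (g b - g a)]
    exact exists_measure_sdiff_singleton_eq_zero hxy fun w hw =>
      hU.interaction_eq_zero hK1 hK2 hK3 hab hlam hg hgm hp hUp hpM hC hax hxy hyb hlt hw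
  have hcount : ∀ M C : ℝ, |g b - g a| ≤ M → IsK2Const K M C →
      (jumpSet a b U).encard ≤ ((⌊(b - a) * lam / (2 * C)⌋₊ + 1 : ℕ) : ℕ∞) := by
    intro M C hM hC
    have hCpos := hC.1
    have hδ : 0 < 2 * C / lam := by positivity
    have e : (b - a) * lam / (2 * C) = (b - a) / (2 * C / lam) := by field_simp
    rw [hJ, e]
    exact encard_le_of_separated hδ hJab fun x hx y hy hxy =>
      le_sub_of_atoms hp (hshort M C hM hC) hx hy hxy
  refine ⟨⟨fun x => c + p.real (Iic x), ⟨hUp.symm, fun x hx => ?_⟩, fun x _ y _ hxy => ?_, ?_,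
    fun x _ => ⟨?_, ?_⟩⟩, hcount⟩
  -- This includes the end points, since the jump set lies in the open interval and `p` does not
  -- charge its complement.
  · have hx0 : p {x} = 0 := by
      by_contra hne
      exact hx.2 (hJ ▸ hne)
    have h1 : p.real (Iio x) = p.real (Iic x) := by
      rw [← measureReal_Iio_add_singleton x, measureReal_def p {x}, hx0, ENNReal.toReal_zero,
        add_zero]
    refine (continuousAt_const.add ?_).continuousWithinAt
    rw [continuousAt_iff_continuous_left'_right']
    refine ⟨?_, tendsto_measureReal_Iic_right x⟩
    have h2 := tendsto_measureReal_Iic_left (p := p) x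
    rwa [h1] at h2
  · have := monotone_measureReal_Iic (p := p) hxy
    simp only at this ⊢
    linarith
  -- The summand `1` keeps the bound positive when `g` is constant.
  · obtain ⟨C, hC⟩ := hK2 (|g b - g a| + 1) (by positivity)
    have hM : |g b - g a| ≤ |g b - g a| + 1 := by linarith
    have hCpos := hC.1
    have hJfin : {x | p {x} ≠ 0}.Finite := by
      rw [← encard_lt_top_iff, ← hJ]
      exact (hcount _ C hM hC).trans_lt (ENat.natCast_lt_top _)
    have hdiff : p {x | p {x} = 0} = 0 :=
      measure_nonatoms_eq_zero (by positivity) hp (hshort _ C hM hC)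
    refine isPiecewiseConst_of_finset hJfin.toFinset b hab
      (fun x hx => hJab (hJfin.mem_toFinset.1 hx)) fun s t _ hst _ hJst => ?_
    have hzero : ∀ x ∈ Ioo s t, ∀ y ∈ Ioo s t, x ≤ y → p.real (Iic x) = p.real (Iic y) := by
      intro x hx y hy hxy
      have h1 := measureReal_Iic_sub (p := p) hxy
      have h2 : p (Ioc x y) = 0 := measure_mono_null (fun w hw => by
        by_contra hne
        exact hJst w (hJfin.mem_toFinset.2 hne) ⟨hx.1.trans hw.1, hw.2.trans_lt hy.2⟩) hdiff
      rw [measureReal_def p (Ioc x y), h2, ENNReal.toReal_zero] at h1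
      linarith
    obtain ⟨m, hm⟩ := nonempty_Ioo.2 hst
    refine ⟨c + p.real (Iic m), fun x hx => ?_⟩
    rcases le_total x m with h | h
    · rw [hzero x hx m hm h]
    · rw [hzero m hm x hx h]
  · have : 0 ≤ p.real (Iic x) := measureReal_nonneg
    linarith
  · have : p.real (Iic x) ≤ p.real univ := measureReal_mono (subset_univ _)
    linarith

end Structure

/-! ### Change of sign -/

section Neg

variable {K g u : ℝ → ℝ} {a b lam : ℝ}

lemma bvRep_neg (j : JordanDecomposition ℝ) (c x : ℝ) : bvRep (-j) (-c) x = -bvRep j c x := by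
  simp only [bvRep, JordanDecomposition.neg_posPart, JordanDecomposition.neg_negPart]
  ring

lemma exists_bvRep_neg (hab : a < b) (hu : MemBV a b u) :
    ∃ j : JordanDecomposition ℝ, ∃ c, (j.posPart + j.negPart) (Ioo a b)ᶜ = 0 ∧
      u =ᵐ[volume.restrict (Ioo a b)] bvRep j c ∧
      ((-j).posPart + (-j).negPart) (Ioo a b)ᶜ = 0 ∧
      (fun x => -u x) =ᵐ[volume.restrict (Ioo a b)] bvRep (-j) (-c) := by
  obtain ⟨j, c, hj, hu⟩ := hu.exists_bvRep hab
  refine ⟨j, c, hj, hu, ?_, ?_⟩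
  · rwa [JordanDecomposition.neg_posPart, JordanDecomposition.neg_negPart, add_comm]
  · filter_upwards [hu] with x hx
    rw [bvRep_neg, hx]

lemma MemBV.neg (hab : a < b) (hu : MemBV a b u) : MemBV a b fun x => -u x := by
  obtain ⟨j, c, -, -, hj, hu⟩ := exists_bvRep_neg hab hu
  exact memBV_of_ae_eq_bvRep hj hu

lemma jumpSet_neg (hab : a < b) (hu : MemBV a b u) :
    jumpSet a b (fun x => -u x) = jumpSet a b u := by
  obtain ⟨j, c, hj, hu, hj', hu'⟩ := exists_bvRep_neg hab hu
  rw [jumpSet_eq hj hu, jumpSet_eq hj' hu', JordanDecomposition.neg_posPart,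
    JordanDecomposition.neg_negPart, add_comm]

/-- Negation swaps the two Jordan parts, leaving the total variation unchanged. -/
lemma TVKg_neg (hK : CondK1 K) (hab : a < b) (hu : MemBV a b u) :
    TVKg K lam (fun x => -g x) a b (fun x => -u x) = TVKg K lam g a b u := by
  obtain ⟨j, c, hj, hu, hj', hu'⟩ := exists_bvRep_neg hab hu
  rw [TVKg, TVKg, TVK_eq hK hab hj hu, TVK_eq hK hab hj' hu', JordanDecomposition.neg_posPart,
    JordanDecomposition.neg_negPart, add_comm j.negPart]
  congr 1
  rw [fidelity, fidelity]
  simp_rw [neg_sub_neg, abs_sub_comm]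

lemma IsMinimizer.neg (hK : CondK1 K) (hab : a < b) (hu : IsMinimizer K lam g a b u) :
    IsMinimizer K lam (fun x => -g x) a b fun x => -u x := by
  refine ⟨hu.1.neg hab, fun v hv => ?_⟩
  have h := hu.2 _ (hv.neg hab)
  rw [← TVKg_neg hK hab (hv.neg hab)] at h
  rw [TVKg_neg hK hab hu.1]
  simpa only [neg_neg] using h

lemma IsPiecewiseConst.neg (hu : IsPiecewiseConst a b u) :
    IsPiecewiseConst a b fun x => -u x := by
  obtain ⟨n, t, c, h0, hn, h⟩ := hu
  exact ⟨n, t, fun i => -c i, h0, hn, fun i hi => ⟨(h i hi).1, fun x hx =>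
    congrArg Neg.neg ((h i hi).2 x hx)⟩⟩

end Neg

end JumpTV

open JumpTV in
theorem theorem1p2
    (K : ℝ → ℝ) (hK1 : CondK1 K) (hK2 : CondK2 K) (hK3 : CondK3 K)
    (a b : ℝ) (hab : a < b) (lam : ℝ) (hlam : 0 < lam)
    (g : ℝ → ℝ) (hg : ContinuousOn g (Icc a b))
    (U : ℝ → ℝ) (hU : IsMinimizer K lam g a b U) :
    (MonotoneOn g (Icc a b) →
      ∃ V : ℝ → ℝ, IsGoodRep a b U V ∧ MonotoneOn V (Icc a b) ∧ IsPiecewiseConst a b V ∧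
        ∀ x ∈ Icc a b, sInf (g '' Icc a b) ≤ V x ∧ V x ≤ sSup (g '' Icc a b)) ∧
    (AntitoneOn g (Icc a b) →
      ∃ V : ℝ → ℝ, IsGoodRep a b U V ∧ AntitoneOn V (Icc a b) ∧ IsPiecewiseConst a b V ∧
        ∀ x ∈ Icc a b, sInf (g '' Icc a b) ≤ V x ∧ V x ≤ sSup (g '' Icc a b)) ∧
    (MonotoneOn g (Icc a b) ∨ AntitoneOn g (Icc a b) →
      ∀ M C : ℝ, 0 < M → |g b - g a| ≤ M → IsK2Const K M C →
        (jumpSet a b U).encard ≤ ((⌊(b - a) * lam / (2 * C)⌋₊ + 1 : ℕ) : ℕ∞)) := by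
  have ha : a ∈ Icc a b := left_mem_Icc.2 hab.le
  have hb : b ∈ Icc a b := right_mem_Icc.2 hab.le
  have hcpt := isCompact_Icc.image_of_continuousOn hg
  have hrange : ∀ x ∈ Icc a b, sInf (g '' Icc a b) ≤ g x ∧ g x ≤ sSup (g '' Icc a b) :=
    fun x hx => ⟨csInf_le hcpt.bddBelow ⟨x, hx, rfl⟩, le_csSup hcpt.bddAbove ⟨x, hx, rfl⟩⟩
  -- For nonincreasing data, `-U` minimizes the energy with the nondecreasing datum `-g`.
  have hanti := fun h : AntitoneOn g (Icc a b) =>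
    (hU.neg hK1 hab).exists_rep hK1 hK2 hK3 hab hlam hg.neg h.neg
  refine ⟨fun h => ?_, fun h => ?_, fun h M C _ hM hC => ?_⟩
  · obtain ⟨V, h1, h2, h3, h4⟩ := (hU.exists_rep hK1 hK2 hK3 hab hlam hg h).1
    exact ⟨V, h1, h2, h3, fun x hx => ⟨(hrange a ha).1.trans (h4 x hx).1,
      (h4 x hx).2.trans (hrange b hb).2⟩⟩
  · obtain ⟨V, h1, h2, h3, h4⟩ := (hanti h).1
    refine ⟨fun x => -V x, ⟨?_, fun x hx => ?_⟩, h2.neg, h3.neg, fun x hx => ?_⟩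
    · filter_upwards [h1.1] with x hx
      rw [hx, neg_neg]
    · rw [← jumpSet_neg hab hU.1] at hx
      exact (h1.2 x hx).neg
    · have := h4 x hx
      constructor
      · linarith [(hrange b hb).1]
      · linarith [(hrange a ha).2]
  · rcases h with h | h
    · exact (hU.exists_rep hK1 hK2 hK3 hab hlam hg h).2 M C hM hC
    · rw [← jumpSet_neg hab hU.1]
      refine (hanti h).2 M C ?_ hC
      rwa [neg_sub_neg, abs_sub_comm]
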